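/- Let $M$ be a smooth manifold of dimension $n\ge 3$ with a (positive definite) smooth Riemannian metric $g$, Levi-Civita connection $\nabla$, Ricci tensor $\mathsf{Ri}$ and scalar curvature $\mathsf{sc}$, and suppose that $\mathsf{Ri}$ does not vanish identically on any connected component of $M$. Suppose that * $\mathsf{Ri}$ is pseudo Ricci symmetric: there is a smooth one form $\alpha\neq 0$ with $$(\nabla_U\mathsf{Ri})(V,W)=2\alpha(U)\,\mathsf{Ri}(V,W)+\alpha(V)\,\mathsf{Ri}(U,W)+\alpha(W)\,\mathsf{Ri}(V,U)\quad\text{for all } U,V,W;$$ * $\mathsf{Ri}$ is quasi Einstein: there are smooth functions $a,b$ and a smooth nowhere vanishing one form $\omega$ with $$\mathsf{Ri}=a\,g+b\,\frac{\omega\otimes\omega}{|\omega|^2}.$$ Let $\alpha^\sharp$ be the vector field with $g(\alpha^\sharp,\cdot)=\alpha$. Then the following hold. 1. At every point where $a\ne 0$ and $\alpha\neq 0$, $$\mathsf{Ri}=\frac{\mathsf{sc}}{n-1}\Big(g-\frac{\alpha\otimes\alpha}{|\alpha|^2}\Big).$$ 2. At every point where $a=0$, $$g(\omega,\alpha)=0,\qquad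 \mathsf{Ri}=\mathsf{sc}\,\frac{\omega\otimes\omega}{|\omega|^2},\qquad (\nabla_U\,\omega)(\alpha^\sharp)=|\alpha|^2\,\omega(U)\ \text{ for all tangent vectors } U$$ (in index notation $\alpha^i\omega_{i;\ell}=|\alpha|^2\omega_\ell$). If moreover $\omega$ is scaled so that $\mathsf{sc}=c\,|\omega|^2$ near the point, with some constant $c$, then also $\nabla_{\alpha^\sharp}\omega=|\alpha|^2\omega$ at that point. -/

import Mathlib

open Bundle Manifold VectorField
open scoped ContDiff Topology

noncomputable section

set_option linter.unusedSectionVars false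

namespace RicciGeometry

variable {E : Type*} [NormedAddCommGroup E] [NormedSpace ℝ E] [FiniteDimensional ℝ E]
  {H : Type*} [TopologicalSpace H] {I : ModelWithCorners ℝ E H}
  {M : Type*} [TopologicalSpace M] [ChartedSpace H M] [IsManifold I ∞ M]

instance instFiniteDimensionalTangentSpace (p : M) : FiniteDimensional ℝ (TangentSpace I p) :=
  inferInstanceAs (FiniteDimensional ℝ E)

instance instT2SpaceTangentSpace (p : M) : T2Space (TangentSpace I p) :=
  inferInstanceAs (T2Space E)

variable (g : ContMDiffRiemannianMetric I ∞ E (fun x : M ↦ TangentSpace I x))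

/-! ### The metric and its musical isomorphism -/

/-- The metric at a point, as a bilinear form. -/
def metricForm (p : M) : LinearMap.BilinForm ℝ (TangentSpace I p) :=
  (ContinuousLinearMap.coeLM ℝ).comp (g.inner p).toLinearMap

@[simp]
theorem metricForm_apply (p : M) (v w : TangentSpace I p) :
    metricForm g p v w = g.inner p v w := rfl

theorem metricForm_nondegenerate (p : M) : (metricForm g p).Nondegenerate := by
  refine ⟨fun v hv ↦ ?_, fun v hv ↦ ?_⟩ <;>
  · by_contra h
    exact (g.pos p v h).ne' (hv v)

/-- The vector `α♯` metrically dual to a covector `α`, i.e. `g(α♯, v) = α(v)` for all `v`. -/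
def sharp (p : M) : (TangentSpace I p →L[ℝ] ℝ) →ₗ[ℝ] TangentSpace I p :=
  ((metricForm g p).toDual (metricForm_nondegenerate g p)).symm.toLinearMap ∘ₗ
    ContinuousLinearMap.coeLM ℝ

@[simp]
theorem inner_sharp (p : M) (α : TangentSpace I p →L[ℝ] ℝ) (v : TangentSpace I p) :
    g.inner p (sharp g p α) v = α v :=
  LinearMap.BilinForm.apply_toDual_symm_apply (B := metricForm g p)
    (hB := metricForm_nondegenerate g p) α.toLinearMap v

/-- The scalar product `g(α, β)` of two covectors. -/
def coInner (p : M) (α β : TangentSpace I p →L[ℝ] ℝ) : ℝ := α (sharp g p β)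

/-! ### The Levi-Civita connection -/

theorem mdifferentiableAt_inner {X Y : Π x : M, TangentSpace I x} {p : M}
    (hX : MDiffAt (T% X) p) (hY : MDiffAt (T% Y) p) :
    MDiffAt (fun x ↦ g.inner x (X x) (Y x)) p := by
  have : MDifferentiableAt I (I.prod 𝓘(ℝ))
      (fun m ↦ TotalSpace.mk' ℝ (E := Bundle.Trivial M ℝ) m (g.inner m (X m) (Y m))) p := by
    apply MDifferentiableAt.clm_bundle_apply₂ (F₁ := E) (F₂ := E)
    · exact (g.contMDiff.mdifferentiable (by simp)).mdifferentiableAt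
    · exact hX
    · exact hY
  simp only [mdifferentiableAt_totalSpace] at this
  exact this.2

/-- The right-hand side of the Koszul formula for `2 g(∇_X Y, Z)`. -/
def koszul (X Y Z : Π x : M, TangentSpace I x) (p : M) : ℝ :=
  d% (fun x ↦ g.inner x (Y x) (Z x)) p (X p) + d% (fun x ↦ g.inner x (X x) (Z x)) p (Y p)
    - d% (fun x ↦ g.inner x (X x) (Y x)) p (Z p)
    + g.inner p (mlieBracket I X Y p) (Z p) - g.inner p (mlieBracket I X Z p) (Y p)
    - g.inner p (mlieBracket I Y Z p) (X p)

theorem koszul_tensorial₁ {Y Z : Π x : M, TangentSpace I x} {p : M}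
    (hY : MDiffAt (T% Y) p) (hZ : MDiffAt (T% Z) p) :
    TensorialAt I E (fun X ↦ koszul g X Y Z p) p where
  smul {f X} hf hX := by
    have h1 := mvfderiv_fun_mul hf (mdifferentiableAt_inner g hX hZ)
    have h2 := mvfderiv_fun_mul hf (mdifferentiableAt_inner g hX hY)
    simp [koszul, mlieBracket_smul_left hf hX, h1, h2]
    ring
  add {X X'} hX hX' := by
    have h1 := mvfderiv_fun_add (mdifferentiableAt_inner g hX hZ) (mdifferentiableAt_inner g hX' hZ)
    have h2 := mvfderiv_fun_add (mdifferentiableAt_inner g hX hY) (mdifferentiableAt_inner g hX' hY)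
    simp [koszul, mlieBracket_add_left hX hX', h1, h2]
    ring

theorem koszul_tensorial₃ {X Y : Π x : M, TangentSpace I x} {p : M}
    (hX : MDiffAt (T% X) p) (hY : MDiffAt (T% Y) p) :
    TensorialAt I E (fun Z ↦ koszul g X Y Z p) p where
  smul {f Z} hf hZ := by
    have h1 := mvfderiv_fun_mul hf (mdifferentiableAt_inner g hX hZ)
    have h2 := mvfderiv_fun_mul hf (mdifferentiableAt_inner g hY hZ)
    simp [koszul, mlieBracket_smul_right hf hZ, h1, h2]
    rw [g.symm p (Z p) (Y p), g.symm p (Z p) (X p)]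
    ring
  add {Z Z'} hZ hZ' := by
    have h1 := mvfderiv_fun_add (mdifferentiableAt_inner g hX hZ) (mdifferentiableAt_inner g hX hZ')
    have h2 := mvfderiv_fun_add (mdifferentiableAt_inner g hY hZ) (mdifferentiableAt_inner g hY hZ')
    simp [koszul, mlieBracket_add_right hZ hZ', h1, h2]
    ring

open Classical in
/-- The covariant derivative `v ↦ ∇_v Y` at `p` of a vector field `Y` which is differentiable at
`p`, defined by the Koszul formula (junk value `0` if `Y` is not differentiable at `p`). -/
def leviCivitaFun (Y : Π x : M, TangentSpace I x) (p : M) :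
    TangentSpace I p →L[ℝ] TangentSpace I p :=
  if hY : MDiffAt (T% Y) p then
    (2⁻¹ : ℝ) • LinearMap.toContinuousLinearMap (sharp g p ∘ₗ
      (TensorialAt.mkHom₂ (F := E) (F' := E) (I := I) (fun X Z ↦ koszul g X Y Z p) p
        (fun _ hZ ↦ koszul_tensorial₁ g hY hZ)
        (fun _ hX ↦ koszul_tensorial₃ g hX hY)).toLinearMap)
  else 0

/-- The Koszul formula. -/
theorem inner_leviCivitaFun {X Y Z : Π x : M, TangentSpace I x} {p : M}
    (hX : MDiffAt (T% X) p) (hY : MDiffAt (T% Y) p) (hZ : MDiffAt (T% Z) p) :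
    g.inner p (leviCivitaFun g Y p (X p)) (Z p) = 2⁻¹ * koszul g X Y Z p := by
  simp only [leviCivitaFun, hY, dif_pos]
  simp
  rw [TensorialAt.mkHom₂_apply (Φ := fun X Z ↦ koszul g X Y Z p) _ _ hX hZ]

theorem eq_of_inner_eq {p : M} {v w : TangentSpace I p}
    (h : ∀ z, g.inner p v z = g.inner p w z) : v = w := by
  by_contra hvw
  have := g.pos p (v - w) (sub_ne_zero.2 hvw)
  simp [h] at this

theorem clm_ext_of_inner {p : M} {A B : TangentSpace I p →L[ℝ] TangentSpace I p}
    (h : ∀ X Z : Π x : M, TangentSpace I x, MDiffAt (T% X) p → MDiffAt (T% Z) p →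
      g.inner p (A (X p)) (Z p) = g.inner p (B (X p)) (Z p)) : A = B := by
  ext v
  refine eq_of_inner_eq g fun z ↦ ?_
  simpa using h _ _ (FiberBundle.mdifferentiableAt_extend I E v) (FiberBundle.mdifferentiableAt_extend I E z)

/-- The Levi-Civita connection of the metric `g`. -/
def leviCivita : CovariantDerivative I E (fun x : M ↦ TangentSpace I x) where
  toFun := leviCivitaFun g
  isCovariantDerivativeOnUniv :=
    { add := by
        intro Y Y' p hY hY' _
        refine clm_ext_of_inner g fun X Z hX hZ ↦ ?_
        have hs := mdifferentiableAt_add_section hY hY'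
        have h1 := mvfderiv_fun_add (mdifferentiableAt_inner g hY hZ)
          (mdifferentiableAt_inner g hY' hZ)
        have h2 := mvfderiv_fun_add (mdifferentiableAt_inner g hX hY)
          (mdifferentiableAt_inner g hX hY')
        rw [inner_leviCivitaFun g hX hs hZ]
        simp only [add_apply, map_add]
        rw [inner_leviCivitaFun g hX hY hZ, inner_leviCivitaFun g hX hY' hZ]
        simp [koszul, mlieBracket_add_right hY hY', mlieBracket_add_left hY hY', h1, h2]
        ring
      leibniz := by
        intro Y f p hY hf _
        refine clm_ext_of_inner g fun X Z hX hZ ↦ ?_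
        have hs := hf.smul_section hY
        have h1 := mvfderiv_fun_mul hf (mdifferentiableAt_inner g hY hZ)
        have h2 := mvfderiv_fun_mul hf (mdifferentiableAt_inner g hX hY)
        rw [inner_leviCivitaFun g hX hs hZ]
        simp
        rw [inner_leviCivitaFun g hX hY hZ]
        simp [koszul, mlieBracket_smul_right hf hY, mlieBracket_smul_left hf hY, h1, h2]
        rw [g.symm p (Y p) (X p)]
        ring }

/-- The Koszul formula. -/
theorem inner_leviCivita {X Y Z : Π x : M, TangentSpace I x} {p : M}
    (hX : MDiffAt (T% X) p) (hY : MDiffAt (T% Y) p) (hZ : MDiffAt (T% Z) p) :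
    g.inner p (leviCivita g Y p (X p)) (Z p) = 2⁻¹ * koszul g X Y Z p :=
  inner_leviCivitaFun g hX hY hZ

/-- The Levi-Civita connection is torsion free. -/
theorem leviCivita_torsion : (leviCivita g).torsion = 0 := by
  rw [CovariantDerivative.torsion_eq_zero_iff]
  intro X Y p hX hY
  refine eq_of_inner_eq g fun z ↦ ?_
  have hz := FiberBundle.mdifferentiableAt_extend I E z
  have h1 := inner_leviCivita g hX hY hz
  have h2 := inner_leviCivita g hY hX hz
  have h3 := mlieBracket_swap_apply (I := I) (V := X) (W := Y) (x := p)
  have h4 : (fun x ↦ g.inner x (X x) (Y x)) = fun x ↦ g.inner x (Y x) (X x) :=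
    funext fun x ↦ g.symm x _ _
  simp only [FiberBundle.extend_apply_self, koszul, h3, h4] at h1 h2
  simp at h1 h2 ⊢
  rw [h1, h2, h3]
  simp
  ring

/-- The Levi-Civita connection is compatible with the metric. -/
theorem leviCivita_metric {Y Z : Π x : M, TangentSpace I x} {p : M}
    (hY : MDiffAt (T% Y) p) (hZ : MDiffAt (T% Z) p) (v : TangentSpace I p) :
    d% (fun x ↦ g.inner x (Y x) (Z x)) p v =
      g.inner p (leviCivita g Y p v) (Z p) + g.inner p (Y p) (leviCivita g Z p v) := by
  have hv := FiberBundle.mdifferentiableAt_extend I E v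
  have h1 := inner_leviCivita g hv hY hZ
  have h2 := inner_leviCivita g hv hZ hY
  have h3 := mlieBracket_swap_apply (I := I) (V := Y) (W := Z) (x := p)
  have h4 : (fun x ↦ g.inner x (Z x) (Y x)) = fun x ↦ g.inner x (Y x) (Z x) :=
    funext fun x ↦ g.symm x _ _
  simp only [FiberBundle.extend_apply_self, koszul, h3, h4] at h1 h2
  rw [g.symm p (Y p), h1, h2]
  simp
  ring

/-! ### Curvature -/

/-- The curvature operator `R(X, Y)Z = ∇_X ∇_Y Z - ∇_Y ∇_X Z - ∇_[X,Y] Z`. -/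
def curvature (X Y Z : Π x : M, TangentSpace I x) (p : M) : TangentSpace I p :=
  leviCivita g (fun x ↦ leviCivita g Z x (Y x)) p (X p)
    - leviCivita g (fun x ↦ leviCivita g Z x (X x)) p (Y p)
    - leviCivita g Z p (mlieBracket I X Y p)

/-- An extension of a tangent vector at `p` to a vector field which is smooth near `p`. -/
def extVec {p : M} (v : TangentSpace I p) : Π x : M, TangentSpace I x :=
  FiberBundle.extend E v

/-- The Ricci tensor: `Ri(v, w)` is the trace of `u ↦ R(u, v)w`. -/
def ricci (p : M) (v w : TangentSpace I p) : ℝ :=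
  let b := Module.finBasis ℝ (TangentSpace I p)
  ∑ i, b.coord i (curvature g (extVec (b i)) (extVec v) (extVec w) p)

/-- The scalar curvature: the trace of the Ricci tensor with respect to the metric. -/
def scalarCurvature (p : M) : ℝ :=
  let b := Module.finBasis ℝ (TangentSpace I p)
  ∑ i, ricci g p (b i) (sharp g p (b.coord i).toContinuousLinearMap)

/-- A (not necessarily smooth) one form on `M`. -/
abbrev OneForm (I : ModelWithCorners ℝ E H) (M : Type*) [TopologicalSpace M] [ChartedSpace H M] :=
  Π x : M, TangentSpace I x →L[ℝ] ℝ

/-- Smoothness of a one form, as a section of the cotangent bundle. -/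
def OneForm.IsSmooth (α : OneForm I M) : Prop :=
  ContMDiff I (I.prod 𝓘(ℝ, E →L[ℝ] ℝ)) ∞
    (fun x ↦ TotalSpace.mk' (E →L[ℝ] ℝ)
      (E := fun x : M ↦ TangentSpace I x →L[ℝ] Bundle.Trivial M ℝ x) x (α x))

/-- The covariant derivative of a one form: `(∇_u θ)(v) = u(θ(V)) - θ(∇_u V)`, where `V` is any
local extension of `v`. -/
def covDerivForm (θ : OneForm I M) (p : M) (u v : TangentSpace I p) : ℝ :=
  d% (fun x ↦ θ x (extVec v x)) p u - θ p (leviCivita g (extVec v) p u)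

/-- The covariant derivative of the Ricci tensor:
`(∇_u Ri)(v, w) = u(Ri(V, W)) - Ri(∇_u V, w) - Ri(v, ∇_u W)`, where `V`, `W` are any local
extensions of `v`, `w`. -/
def covDerivRicci (p : M) (u v w : TangentSpace I p) : ℝ :=
  d% (fun x ↦ ricci g x (extVec v x) (extVec w x)) p u
    - ricci g p (leviCivita g (extVec v) p u) w - ricci g p v (leviCivita g (extVec w) p u)

/-- The Ricci tensor is pseudo Ricci symmetric with associated one form `α`. -/
structure IsPseudoRicciSymmetric (α : OneForm I M) : Prop where
  smooth : α.IsSmooth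
  ne_zero : ∃ p, α p ≠ 0
  eq : ∀ (p : M) (u v w : TangentSpace I p), covDerivRicci g p u v w =
    2 * α p u * ricci g p v w + α p v * ricci g p u w + α p w * ricci g p v u

/-- The Ricci tensor is quasi Einstein: `Ri = a g + b θ ⊗ θ / |θ|²`. -/
structure IsQuasiEinstein (a b : M → ℝ) (θ : OneForm I M) : Prop where
  smooth_a : ContMDiff I 𝓘(ℝ) ∞ a
  smooth_b : ContMDiff I 𝓘(ℝ) ∞ b
  smooth_form : θ.IsSmooth
  ne_zero : ∀ p, θ p ≠ 0
  eq : ∀ (p : M) (v w : TangentSpace I p), ricci g p v w =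
    a p * g.inner p v w + b p * (θ p v * θ p w / coInner g p (θ p) (θ p))

end RicciGeometry

end

noncomputable section

set_option linter.unusedSectionVars false

namespace RicciGeometry.Local

variable {E : Type*} [NormedAddCommGroup E] [NormedSpace ℝ E]

/-! The key identity is Ri(α♯, ·) = 0 (`IsPseudoRicciSymmetric.ricci_sharp`). The contracted second
Bianchi identity says that the trace of ∇_u Ri is twice the divergence of Ri at u. Inserting the
pseudo Ricci symmetric equation gives 2 sc α(u) + 2 Ri(u, α♯) on one side and 2 sc α(u) + 6 Ri(u,
α♯) on the other.

For a quasi Einstein Ricci tensor, with N = |ω|² and c = g(ω, α), this reads a α + (b/N) c ω = 0.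
Everything else is algebra with this identity and the covariant derivative of Ri = a g + (b/N) ω ⊗
ω. If a ≠ 0 and α ≠ 0, evaluating at α♯ and ω♯ gives c ≠ 0 and b = -a, so α is proportional to ω and
sc = (n - 1) a. If a = 0 and b ≠ 0, then c = 0, and comparing two expressions for ∇Ri at suitable
arguments gives the statements about ∇ω.

It remains to exclude a = b = 0 at a point. The eigenvalues satisfy da = 2aα and d(a + b) = 2(a +
b)α, so by Grönwall their zero sets are clopen. A common zero would force Ri = 0 on a whole
connected component.

The Bianchi identity is proved for connections D + Γ on a vector space (`Local.sum_covRic`) and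
carried over to M through charts. -/

instance instNormedAddCommGroupCLM₂ {F : Type*} [NormedAddCommGroup F] [NormedSpace ℝ F] :
    NormedAddCommGroup (E →L[ℝ] E →L[ℝ] F) := ContinuousLinearMap.toNormedAddCommGroup

instance instNormedSpaceCLM₂ {F : Type*} [NormedAddCommGroup F] [NormedSpace ℝ F] :
    NormedSpace ℝ (E →L[ℝ] E →L[ℝ] F) := ContinuousLinearMap.toNormedSpace

instance instNormedAddCommGroupCLM₃ {F : Type*} [NormedAddCommGroup F] [NormedSpace ℝ F] :
    NormedAddCommGroup (E →L[ℝ] E →L[ℝ] E →L[ℝ] F) := ContinuousLinearMap.toNormedAddCommGroup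

instance instNormedSpaceCLM₃ {F : Type*} [NormedAddCommGroup F] [NormedSpace ℝ F] :
    NormedSpace ℝ (E →L[ℝ] E →L[ℝ] E →L[ℝ] F) := ContinuousLinearMap.toNormedSpace

theorem differentiableAt_fderiv {F : Type*} [NormedAddCommGroup F] [NormedSpace ℝ F] {f : E → F}
    {y : E} (hf : ContDiffAt ℝ 2 f y) : DifferentiableAt ℝ (fderiv ℝ f) y :=
  (hf.fderiv_right (m := 1) (by norm_num)).differentiableAt (by norm_num)

theorem hasFDerivAt_of_contDiffAt_two {F : Type*} [NormedAddCommGroup F] [NormedSpace ℝ F]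
    {f : E → F} {y : E} (hf : ContDiffAt ℝ 2 f y) : HasFDerivAt f (fderiv ℝ f y) y :=
  (hf.differentiableAt (by norm_num)).hasFDerivAt

theorem fderiv_fderiv_symm {F : Type*} [NormedAddCommGroup F] [NormedSpace ℝ F] {f : E → F}
    {y : E} (hf : ContDiffAt ℝ 2 f y) (u v : E) :
    fderiv ℝ (fderiv ℝ f) y u v = fderiv ℝ (fderiv ℝ f) y v u :=
  (hf.isSymmSndFDerivAt (by simp)) u v

/-- The directional derivative of `z ↦ f z w`. -/
theorem _root_.HasFDerivAt.clm_apply_const {F F' : Type*} [NormedAddCommGroup F] [NormedSpace ℝ F]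
    [NormedAddCommGroup F'] [NormedSpace ℝ F'] {f : E → F →L[ℝ] F'} {f' : E →L[ℝ] F →L[ℝ] F'}
    {y : E} (hf : HasFDerivAt f f' y) (w : F) : HasFDerivAt (fun z ↦ f z w) (f'.flip w) y := by
  simpa using hf.clm_apply (hasFDerivAt_const w y)

/-! ### Curvature of a connection on an open subset of a vector space -/

/-- The curvature operator of the connection `D + Γ`. -/
def riem (Γ : E → E →L[ℝ] E →L[ℝ] E) (y : E) (u v : E) : E →L[ℝ] E :=
  fderiv ℝ Γ y u v - fderiv ℝ Γ y v u + Γ y u * Γ y v - Γ y v * Γ y u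

/-- The covariant derivative of the curvature operator. -/
def covRiem (Γ : E → E →L[ℝ] E →L[ℝ] E) (y : E) (x u v : E) : E →L[ℝ] E :=
  fderiv ℝ (fun z ↦ riem Γ z u v) y x + Γ y x * riem Γ y u v - riem Γ y u v * Γ y x
    - riem Γ y (Γ y x u) v - riem Γ y u (Γ y x v)

variable {Γ : E → E →L[ℝ] E →L[ℝ] E} {y : E}

theorem riem_swap (u v : E) : riem Γ y u v = -riem Γ y v u := by
  simp only [riem]; abel

theorem riem_add_left (u u' v : E) : riem Γ y (u + u') v = riem Γ y u v + riem Γ y u' v := by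
  simp only [riem, map_add, add_apply, add_mul, mul_add]; abel

theorem riem_smul_left (c : ℝ) (u v : E) : riem Γ y (c • u) v = c • riem Γ y u v := by
  simp only [riem, map_smul, smul_apply, smul_mul_assoc, mul_smul_comm, smul_sub, smul_add]

theorem hasFDerivAt_riem (hΓ : ContDiffAt ℝ 2 Γ y) (u v : E) :
    ∃ R' : E →L[ℝ] E →L[ℝ] E, HasFDerivAt (fun z ↦ riem Γ z u v) R' y ∧ ∀ x, R' x =
      fderiv ℝ (fderiv ℝ Γ) y x u v - fderiv ℝ (fderiv ℝ Γ) y x v u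
      + fderiv ℝ Γ y x u * Γ y v + Γ y u * fderiv ℝ Γ y x v
      - fderiv ℝ Γ y x v * Γ y u - Γ y v * fderiv ℝ Γ y x u := by
  have a := (hasFDerivAt_of_contDiffAt_two hΓ).clm_apply_const
  have b (w) := ((differentiableAt_fderiv hΓ).hasFDerivAt.clm_apply_const w).clm_apply_const
  refine ⟨_, (((b u v).sub (b v u)).add ((a u).mul' (a v))).sub ((a v).mul' (a u)), fun x ↦ ?_⟩
  simp only [add_apply, sub_apply, ContinuousLinearMap.flip_apply]
  change _ + (Γ y u * fderiv ℝ Γ y x v + fderiv ℝ Γ y x u * Γ y v)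
    - (Γ y v * fderiv ℝ Γ y x u + fderiv ℝ Γ y x v * Γ y u) = _
  abel

theorem differentiableAt_riem (hΓ : ContDiffAt ℝ 2 Γ y) (u v : E) :
    DifferentiableAt ℝ (fun z ↦ riem Γ z u v) y :=
  let ⟨_, h, _⟩ := hasFDerivAt_riem hΓ u v
  h.differentiableAt

theorem fderiv_riem (hΓ : ContDiffAt ℝ 2 Γ y) (x u v : E) :
    fderiv ℝ (fun z ↦ riem Γ z u v) y x =
      fderiv ℝ (fderiv ℝ Γ) y x u v - fderiv ℝ (fderiv ℝ Γ) y x v u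
      + fderiv ℝ Γ y x u * Γ y v + Γ y u * fderiv ℝ Γ y x v
      - fderiv ℝ Γ y x v * Γ y u - Γ y v * fderiv ℝ Γ y x u := by
  obtain ⟨R', h, hR'⟩ := hasFDerivAt_riem hΓ u v
  rw [h.fderiv, hR']

/-- The second Bianchi identity. -/
theorem covRiem_cyclic (hΓ : ContDiffAt ℝ 2 Γ y) (hs : ∀ u v, Γ y u v = Γ y v u) (x u v : E) :
    covRiem Γ y x u v + covRiem Γ y u v x + covRiem Γ y v x u = 0 := by
  have hsym := fderiv_fderiv_symm hΓ
  -- Symmetry of Γ makes the correction terms R(Γ_x u, v) cancel in pairs, and symmetry of D²Γ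
  -- removes the second derivatives. What remains cancels as in the Jacobi identity for commutators.
  rw [covRiem, covRiem, covRiem, hs x v, hs u x, hs v u, riem_swap u (Γ y v x),
    riem_swap v (Γ y x u), riem_swap x (Γ y u v)]
  simp only [fderiv_riem hΓ, hsym x v, hsym u x, hsym v u]
  simp only [riem]
  noncomm_ring

/-! ### Metric connections -/

variable {G : E → E →L[ℝ] E →L[ℝ] ℝ}

/-- The connection `D + Γ` is compatible with the metric `G` at `y`. -/
def Compatible (Γ : E → E →L[ℝ] E →L[ℝ] E) (G : E → E →L[ℝ] E →L[ℝ] ℝ) (y : E) : Prop :=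
  ∀ u v w, fderiv ℝ G y u v w = G y (Γ y u v) w + G y v (Γ y u w)

/-- Differentiating the compatibility equation once more expresses D²G in terms of Γ and DΓ. Since
D²G is symmetric in u and v, its antisymmetrization vanishes, and this is the claim. -/
theorem skew_riem (hΓ : ContDiffAt ℝ 2 Γ y) (hG : ContDiffAt ℝ 2 G y)
    (hc : ∀ᶠ z in 𝓝 y, Compatible Γ G z) (u v w w' : E) :
    G y (riem Γ y u v w) w' = -G y w (riem Γ y u v w') := by
  have dG := hasFDerivAt_of_contDiffAt_two hG
  have dΓ (u w) := ((hasFDerivAt_of_contDiffAt_two hΓ).clm_apply_const u).clm_apply_const w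
  have key (u v w w' : E) : fderiv ℝ (fderiv ℝ G) y u v w w' =
      G y (fderiv ℝ Γ y u v w) w' + G y w (fderiv ℝ Γ y u v w')
      + (G y (Γ y u (Γ y v w)) w' + G y (Γ y v w) (Γ y u w'))
      + (G y (Γ y u w) (Γ y v w') + G y w (Γ y u (Γ y v w'))) := by
    have h1 := (((differentiableAt_fderiv hG).hasFDerivAt.clm_apply_const v).clm_apply_const
      w).clm_apply_const w'
    have h2 := ((dG.clm_apply (dΓ v w)).clm_apply_const w').add
      ((dG.clm_apply_const w).clm_apply (dΓ v w'))
    have h3 := h1.unique (h2.congr_of_eventuallyEq (hc.mono fun z hz ↦ hz v w w'))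
    have h4 := congrArg (· u) h3
    simp at h4
    rw [h4, hc.self_of_nhds, hc.self_of_nhds]
    ring
  have h1 := key u v w w'
  have h2 := key v u w w'
  rw [fderiv_fderiv_symm hG] at h1
  simp [riem]
  linarith

/-- Being skew is a parallel condition because the metric is parallel: differentiate G(Aw, w') =
-G(w, Aw'). -/
theorem skew_covariant_deriv {A : E → E →L[ℝ] E} (hA : DifferentiableAt ℝ A y)
    (hG : DifferentiableAt ℝ G y) (hc : Compatible Γ G y)
    (hs : ∀ᶠ z in 𝓝 y, ∀ w w', G z (A z w) w' = -G z w (A z w')) (u w w' : E) :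
    G y ((fderiv ℝ A y u + Γ y u * A y - A y * Γ y u) w) w' =
      -G y w ((fderiv ℝ A y u + Γ y u * A y - A y * Γ y u) w') := by
  have h1 := ((hG.hasFDerivAt.clm_apply (hA.hasFDerivAt.clm_apply_const w)).clm_apply_const w')
  have h2 := ((hG.hasFDerivAt.clm_apply_const w).clm_apply (hA.hasFDerivAt.clm_apply_const w')).neg
  have h3 := h1.unique (h2.congr_of_eventuallyEq (hs.mono fun z hz ↦ hz w w'))
  have h4 := congrArg (· u) h3
  simp [hc _ _ _] at h4
  have h5 := hs.self_of_nhds (Γ y u w) w'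
  have h6 := hs.self_of_nhds w (Γ y u w')
  simp
  linarith

theorem skew_covRiem (hΓ : ContDiffAt ℝ 2 Γ y) (hG : ContDiffAt ℝ 2 G y)
    (hc : ∀ᶠ z in 𝓝 y, Compatible Γ G z) (x u v w w' : E) :
    G y (covRiem Γ y x u v w) w' = -G y w (covRiem Γ y x u v w') := by
  have h0 : ∀ᶠ z in 𝓝 y, ContDiffAt ℝ 2 Γ z ∧ ContDiffAt ℝ 2 G z ∧
      ∀ᶠ z' in 𝓝 z, Compatible Γ G z' :=
    (hΓ.eventually (by simp)).and ((hG.eventually (by simp)).and hc.eventually_nhds)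
  have h1 := skew_covariant_deriv (differentiableAt_riem hΓ u v)
    (hG.differentiableAt (by norm_num)) hc.self_of_nhds
    (h0.mono fun z hz ↦ skew_riem hz.1 hz.2.1 hz.2.2 u v) x w w'
  have h2 := skew_riem hΓ hG hc (Γ y x u) v w w'
  have h3 := skew_riem hΓ hG hc u (Γ y x v) w w'
  simp only [covRiem, sub_apply, map_sub] at h1 ⊢
  linarith

theorem fderiv_symm_of_symm (hs : ∀ᶠ z in 𝓝 y, ∀ v w, G z v w = G z w v)
    (hd : DifferentiableAt ℝ G y) (u v w : E) : fderiv ℝ G y u v w = fderiv ℝ G y u w v := by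
  have h1 := (hd.hasFDerivAt.clm_apply_const v).clm_apply_const w
  have h2 := (hd.hasFDerivAt.clm_apply_const w).clm_apply_const v
  exact congrArg (· u) (h1.unique (h2.congr_of_eventuallyEq (hs.mono fun z hz ↦ hz v w)))

/-- In finite dimension an operator is a fixed linear expression in its values on a basis, so
smoothness can be checked entry by entry. -/
theorem contDiffAt_of_clm_apply {F F' : Type*} [NormedAddCommGroup F] [NormedSpace ℝ F]
    [FiniteDimensional ℝ F] [NormedAddCommGroup F'] [NormedSpace ℝ F'] {n : ℕ∞ω}
    {f : E → F →L[ℝ] F'} (h : ∀ v, ContDiffAt ℝ n (fun z ↦ f z v) y) : ContDiffAt ℝ n f y := by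
  let b := Module.finBasis ℝ F
  have hf : f = fun z ↦ ∑ i, (ContinuousLinearMap.smulRightL ℝ F F'
      (b.coord i).toContinuousLinearMap) (f z (b i)) := by
    ext z v
    conv_lhs => rw [← b.sum_repr v, map_sum]
    simp
  rw [hf]
  exact ContDiffAt.sum fun i _ ↦ (ContinuousLinearMap.contDiff _).contDiffAt.comp y (h (b i))

/-! ### Christoffel symbols of a metric on a vector space. -/

section Christoffel

variable [FiniteDimensional ℝ E]

/-- The Christoffel symbols of the first kind (up to a factor `2`), as a function of the derivative
of the metric. -/
def lowerChristoffel (T : E →L[ℝ] E →L[ℝ] E →L[ℝ] ℝ) : E →L[ℝ] E →L[ℝ] E →L[ℝ] ℝ :=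
  T + T.flip - (ContinuousLinearMap.flipₗᵢ ℝ E E ℝ).toContinuousLinearEquiv.toContinuousLinearMap ∘L
    T.flip

theorem lowerChristoffel_apply (T : E →L[ℝ] E →L[ℝ] E →L[ℝ] ℝ) (u v w : E) :
    lowerChristoffel T u v w = T u v w + T v u w - T w u v := rfl

/-- The Christoffel symbols of the metric `G`. -/
def christoffel (G : E → E →L[ℝ] E →L[ℝ] ℝ) (y : E) : E →L[ℝ] E →L[ℝ] E :=
  (2⁻¹ : ℝ) • (ContinuousLinearMap.compL ℝ E (E →L[ℝ] ℝ) E (G y).inverse) ∘L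
    lowerChristoffel (fderiv ℝ G y)

theorem isInvertible_of_pos {B : E →L[ℝ] E →L[ℝ] ℝ} (hB : ∀ v, v ≠ 0 → 0 < B v v) :
    B.IsInvertible := by
  have hinj : Function.Injective B := by
    refine (injective_iff_map_eq_zero B).2 fun v hv ↦ ?_
    by_contra h
    simpa [hv] using hB v h
  have hrank : Module.finrank ℝ E = Module.finrank ℝ (E →L[ℝ] ℝ) := by
    rw [← (LinearMap.toContinuousLinearMap (𝕜 := ℝ) (E := E) (F' := ℝ)).finrank_eq]
    exact Subspace.dual_finrank_eq.symm
  exact ⟨(B.toLinearMap.linearEquivOfInjective hinj hrank).toContinuousLinearEquiv, rfl⟩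

theorem apply_christoffel (hG : (G y).IsInvertible) (u v w : E) :
    G y (christoffel G y u v) w =
      2⁻¹ * (fderiv ℝ G y u v w + fderiv ℝ G y v u w - fderiv ℝ G y w u v) := by
  have h := hG.self_apply_inverse (lowerChristoffel (fderiv ℝ G y) u v)
  simp only [christoffel, smul_apply, map_smul, ContinuousLinearMap.comp_apply,
    ContinuousLinearMap.compL_apply, h, lowerChristoffel_apply, smul_eq_mul]

theorem christoffel_symm (hG : (G y).IsInvertible)
    (hs : ∀ᶠ z in 𝓝 y, ∀ v w, G z v w = G z w v) (hd : DifferentiableAt ℝ G y) (u v : E) :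
    christoffel G y u v = christoffel G y v u := by
  have hDs := fderiv_symm_of_symm hs hd
  refine hG.injective (ContinuousLinearMap.ext fun w ↦ ?_)
  rw [apply_christoffel hG, apply_christoffel hG, hDs w v u]
  ring

theorem compatible_christoffel (hG : (G y).IsInvertible)
    (hs : ∀ᶠ z in 𝓝 y, ∀ v w, G z v w = G z w v) (hd : DifferentiableAt ℝ G y) :
    Compatible (christoffel G) G y := by
  have hDs := fderiv_symm_of_symm hs hd
  intro u v w
  rw [hs.self_of_nhds v, apply_christoffel hG, apply_christoffel hG, hDs u w v, hDs w u v,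
    hDs v u w]
  ring

/-- One derivative is lost, so a C³ metric yields the C² symbols required by the second Bianchi
identity. -/
theorem contDiffAt_christoffel (hG : (G y).IsInvertible) (h : ContDiffAt ℝ 3 G y) :
    ContDiffAt ℝ 2 (christoffel G) y := by
  have h1 : ContDiffAt ℝ 2 (fderiv ℝ G) y := h.fderiv_right (by norm_num)
  have h2 : ContDiffAt ℝ 2 (fun z ↦ (G z).inverse) y :=
    (hG.contDiffAt_map_inverse).comp y (h.of_le (by norm_num))
  have h3 (u v : E) : ContDiffAt ℝ 2 (fun z ↦ lowerChristoffel (fderiv ℝ G z) u v) y := by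
    refine contDiffAt_of_clm_apply fun w ↦ ?_
    have h4 (a b c : E) : ContDiffAt ℝ 2 (fun z ↦ fderiv ℝ G z a b c) y :=
      (((h1.clm_apply contDiffAt_const).clm_apply contDiffAt_const).clm_apply contDiffAt_const)
    exact ((h4 u v w).add (h4 v u w)).sub (h4 w u v)
  exact contDiffAt_of_clm_apply fun u ↦ contDiffAt_of_clm_apply fun v ↦
    contDiffAt_const.smul (h2.clm_apply (h3 u v))

end Christoffel

/-! ### Ricci tensor and contracted Bianchi identity on a vector space. -/

section Ricci

variable [FiniteDimensional ℝ E]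

/-- The Ricci tensor of the connection `D + Γ`. -/
def ric (Γ : E → E →L[ℝ] E →L[ℝ] E) (y v w : E) : ℝ :=
  LinearMap.trace ℝ E
    { toFun := fun u ↦ riem Γ y u v w
      map_add' := fun u u' ↦ by rw [riem_add_left]; rfl
      map_smul' := fun c u ↦ by rw [riem_smul_left]; rfl }

theorem trace_eq_sum_coord {ι : Type*} [Fintype ι] (b : Module.Basis ι ℝ E) (A : E →ₗ[ℝ] E) :
    LinearMap.trace ℝ E A = ∑ i, b.coord i (A (b i)) := by
  classical
  rw [LinearMap.trace_eq_matrix_trace ℝ b]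
  simp [Matrix.trace, LinearMap.toMatrix_apply]

theorem ric_eq_sum {ι : Type*} [Fintype ι] (b : Module.Basis ι ℝ E) (v w : E) :
    ric Γ y v w = ∑ i, b.coord i (riem Γ y (b i) v w) :=
  trace_eq_sum_coord b _

/-- The covariant derivative of the Ricci tensor. -/
def covRic (Γ : E → E →L[ℝ] E →L[ℝ] E) (y u v w : E) : ℝ :=
  fderiv ℝ (fun z ↦ ric Γ z v w) y u - ric Γ y (Γ y u v) w - ric Γ y v (Γ y u w)

theorem hasFDerivAt_ric (hΓ : ContDiffAt ℝ 2 Γ y) {ι : Type*} [Fintype ι]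
    (b : Module.Basis ι ℝ E) (v w : E) :
    HasFDerivAt (fun z ↦ ric Γ z v w) (∑ i, (b.coord i).toContinuousLinearMap ∘L
      (fderiv ℝ (fun z ↦ riem Γ z (b i) v) y).flip w) y := by
  simp only [ric_eq_sum b]
  exact HasFDerivAt.fun_sum fun i _ ↦ ((b.coord i).toContinuousLinearMap.hasFDerivAt).comp y
    ((differentiableAt_riem hΓ (b i) v).hasFDerivAt.clm_apply_const w)

/-- Covariant differentiation commutes with the trace: the correction in the traced slot and the one
in the value cancel by tr(AΓ_u) = tr(Γ_u A). -/
theorem covRic_eq_sum (hΓ : ContDiffAt ℝ 2 Γ y) {ι : Type*} [Fintype ι]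
    (b : Module.Basis ι ℝ E) (u v w : E) :
    covRic Γ y u v w = ∑ i, b.coord i (covRiem Γ y u (b i) v w) := by
  let A : E →ₗ[ℝ] E :=
    { toFun := fun u ↦ riem Γ y u v w
      map_add' := fun u u' ↦ by rw [riem_add_left]; rfl
      map_smul' := fun c u ↦ by rw [riem_smul_left]; rfl }
  have h1 := LinearMap.trace_mul_comm ℝ A (Γ y u).toLinearMap
  rw [trace_eq_sum_coord b, trace_eq_sum_coord b] at h1
  have h2 : ∑ i, b.coord i (riem Γ y (Γ y u (b i)) v w) =
    ∑ i, b.coord i (Γ y u (riem Γ y (b i) v w)) := h1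
  rw [covRic, (hasFDerivAt_ric hΓ b v w).fderiv, ric_eq_sum b, ric_eq_sum b]
  simp only [covRiem, add_apply, sub_apply, map_add, map_sub, Finset.sum_add_distrib,
    Finset.sum_sub_distrib, h2, mul_apply_eq_comp]
  simp
  ring

/-- The contracted second Bianchi identity, with respect to a basis `b` and the basis `b'` which
is dual to it for the metric. -/
theorem sum_covRic (hΓ : ContDiffAt ℝ 2 Γ y) (hG : ContDiffAt ℝ 2 G y)
    (hs : ∀ u v, Γ y u v = Γ y v u) (hc : ∀ᶠ z in 𝓝 y, Compatible Γ G z)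
    (hsymm : ∀ v w, G y v w = G y w v) {ι : Type*} [Fintype ι]
    (b : Module.Basis ι ℝ E) {b' : ι → E} (hb' : ∀ i v, G y (b' i) v = b.coord i v) (u : E) :
    ∑ k, covRic Γ y u (b k) (b' k) = 2 * ∑ k, covRic Γ y (b k) u (b' k) := by
  have hswap (x u v : E) : covRiem Γ y x u v = -covRiem Γ y x v u := by
    simp only [covRiem, fderiv_fun_neg, riem_swap u v, riem_swap (Γ y x u) v,
      riem_swap u (Γ y x v)]
    simp
    abel
  -- The second Bianchi identity traced over i. One of its two terms is already a Ricci trace.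
  have h1 (k) : covRic Γ y u (b k) (b' k) = covRic Γ y (b k) u (b' k) +
      ∑ i, G y (b' i) (covRiem Γ y (b i) u (b k) (b' k)) := by
    simp only [covRic_eq_sum hΓ b, ← Finset.sum_add_distrib, hb']
    refine Finset.sum_congr rfl fun i _ ↦ ?_
    have h := congrArg (fun A ↦ b.coord i (A (b' k))) (covRiem_cyclic hΓ hs (b i) u (b k))
    have h' := congrArg (fun A ↦ b.coord i (A (b' k))) (hswap u (b i) (b k))
    simp at h h' ⊢
    linarith
  -- Skewness in the last pair and in the first pair change the sign twice, so that tracing over k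
  -- turns the other term into the same divergence.
  have h2 : ∑ k, ∑ i, G y (b' i) (covRiem Γ y (b i) u (b k) (b' k)) =
      ∑ k, covRic Γ y (b k) u (b' k) := by
    rw [Finset.sum_comm]
    refine Finset.sum_congr rfl fun i _ ↦ ?_
    rw [covRic_eq_sum hΓ b]
    refine Finset.sum_congr rfl fun k _ ↦ ?_
    rw [← hb', hsymm, skew_covRiem hΓ hG hc, hswap]
    simp
  simp only [h1, Finset.sum_add_distrib, h2]
  ring

end Ricci

/-- The covariant derivative of a vector field. -/
def covField (Γ : E → E →L[ℝ] E →L[ℝ] E) (Z : E → E) (y u : E) : E :=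
  fderiv ℝ Z y u + Γ y u (Z y)

/-- Tensoriality of the curvature: D²Z drops out by symmetry, and the derivatives of X and Y are
absorbed by the bracket term. -/
theorem curvature_covField (hΓ : DifferentiableAt ℝ Γ y)
    {X Y Z : E → E} (hX : DifferentiableAt ℝ X y) (hY : DifferentiableAt ℝ Y y)
    (hZ : ContDiffAt ℝ 2 Z y) :
    covField Γ (fun z ↦ covField Γ Z z (Y z)) y (X y)
      - covField Γ (fun z ↦ covField Γ Z z (X z)) y (Y y)
      - covField Γ Z y (fderiv ℝ Y y (X y) - fderiv ℝ X y (Y y)) =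
    riem Γ y (X y) (Y y) (Z y) := by
  have key {W : E → E} (hW : DifferentiableAt ℝ W y) :=
    (((differentiableAt_fderiv hZ).hasFDerivAt.clm_apply hW.hasFDerivAt).add
      ((hΓ.hasFDerivAt.clm_apply hW.hasFDerivAt).clm_apply
        (hasFDerivAt_of_contDiffAt_two hZ))).fderiv
  have h := fderiv_fderiv_symm hZ (X y) (Y y)
  have hX' : fderiv ℝ (fun z ↦ covField Γ Z z (X z)) y = _ := key hX
  have hY' : fderiv ℝ (fun z ↦ covField Γ Z z (Y z)) y = _ := key hY
  rw [covField, covField.eq_1 Γ (fun z ↦ covField Γ Z z (X z)), hX', hY']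
  simp [covField, riem, h]
  abel

end RicciGeometry.Local

namespace RicciGeometry

open Local

variable {E : Type*} [NormedAddCommGroup E] [NormedSpace ℝ E] [FiniteDimensional ℝ E]
  {M : Type*} [TopologicalSpace M] [ChartedSpace E M] [IsManifold 𝓘(ℝ, E) ∞ M]

/-! ### Representation in a chart -/

/-- The coordinates of a tangent vector at `x` in the chart at `p`. -/
def toModel (p x : M) : TangentSpace 𝓘(ℝ, E) x →L[ℝ] E :=
  (trivializationAt E (TangentSpace 𝓘(ℝ, E)) p).continuousLinearMapAt ℝ x

/-- The tangent vector at `x` with given coordinates in the chart at `p`. -/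
def ofModel (p x : M) : E →L[ℝ] TangentSpace 𝓘(ℝ, E) x :=
  (trivializationAt E (TangentSpace 𝓘(ℝ, E)) p).symmL ℝ x

/-- The representation of a vector field in the chart at `p`. -/
def fieldRep (p : M) (X : Π x : M, TangentSpace 𝓘(ℝ, E) x) (y : E) : E :=
  toModel p ((chartAt E p).symm y) (X ((chartAt E p).symm y))

variable {p x : M}

theorem toModel_ofModel (hx : x ∈ (chartAt E p).source) (v : E) :
    toModel p x (ofModel p x v) = v :=
  (trivializationAt E (TangentSpace 𝓘(ℝ, E)) p).continuousLinearMapAt_symmL (R := ℝ) hx v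

theorem ofModel_toModel (hx : x ∈ (chartAt E p).source) (v : TangentSpace 𝓘(ℝ, E) x) :
    ofModel p x (toModel p x v) = v :=
  (trivializationAt E (TangentSpace 𝓘(ℝ, E)) p).symmL_continuousLinearMapAt (R := ℝ) hx v

theorem toModel_eq (hx : x ∈ (chartAt E p).source) (v : TangentSpace 𝓘(ℝ, E) x) :
    toModel p x v = (trivializationAt E (TangentSpace 𝓘(ℝ, E)) p ⟨x, v⟩).2 := by
  rw [toModel, Trivialization.continuousLinearMapAt_apply, Trivialization.linearMapAt_apply,
    if_pos (show x ∈ (trivializationAt E (TangentSpace 𝓘(ℝ, E)) p).baseSet from hx)]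

/-- The trivialization of the tangent bundle is the derivative of the chart. The translation of
derivatives and brackets into coordinates rests on this. -/
theorem mfderiv_chartAt_symm {y : E} (hy : y ∈ (chartAt E p).target) (v : E) :
    mfderiv 𝓘(ℝ, E) 𝓘(ℝ, E) (chartAt E p).symm y v = ofModel p ((chartAt E p).symm y) v := by
  have h := TangentBundle.symmL_trivializationAt (𝕜 := ℝ) (I := 𝓘(ℝ, E))
    ((chartAt E p).map_target hy)
  rw [ofModel, h]
  let D : E → E →L[ℝ] E := fun z ↦ mfderiv 𝓘(ℝ, E) 𝓘(ℝ, E) (chartAt E p).symm z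
  have h' := congrArg (fun z ↦ D z v) ((chartAt E p).right_inv hy)
  simpa using! h'.symm

theorem contMDiffAt_chartAt_symm (hx : x ∈ (chartAt E p).source) :
    ContMDiffAt 𝓘(ℝ, E) 𝓘(ℝ, E) ∞ (chartAt E p).symm (chartAt E p x) :=
  (contMDiffOn_chart_symm (I := 𝓘(ℝ, E)) (x := p)).contMDiffAt
    ((chartAt E p).open_target.mem_nhds ((chartAt E p).map_source hx))

variable {F : Type*} [NormedAddCommGroup F] [NormedSpace ℝ F] {f : M → F}

theorem mdifferentiableAt_iff_comp_chart (hx : x ∈ (chartAt E p).source) :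
    MDiffAt f x ↔ DifferentiableAt ℝ (f ∘ (chartAt E p).symm) (chartAt E p x) := by
  rw [← mdifferentiableAt_iff_differentiableAt]
  refine ⟨fun h ↦ ?_, fun h ↦ ?_⟩
  · refine MDifferentiableAt.comp (I' := 𝓘(ℝ, E)) _ ?_
      ((contMDiffAt_chartAt_symm hx).mdifferentiableAt (by simp))
    rwa [(chartAt E p).left_inv hx]
  · have h2 := h.comp x (contMDiffAt_of_mem_maximalAtlas (I := 𝓘(ℝ, E)) (n := ∞)
      (IsManifold.chart_mem_maximalAtlas p) hx |>.mdifferentiableAt (by simp))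
    refine h2.congr_of_eventuallyEq ?_
    filter_upwards [(chartAt E p).open_source.mem_nhds hx] with z hz
    simp [(chartAt E p).left_inv hz]

theorem contMDiffAt_iff_comp_chart {n : ℕ∞} (hx : x ∈ (chartAt E p).source) :
    CMDiffAt n f x ↔ ContDiffAt ℝ n (f ∘ (chartAt E p).symm) (chartAt E p x) := by
  rw [← contMDiffAt_iff_contDiffAt]
  refine ⟨fun h ↦ ?_, fun h ↦ ?_⟩
  · refine ContMDiffAt.comp (I' := 𝓘(ℝ, E)) _ ?_
      ((contMDiffAt_chartAt_symm hx).of_le (by exact_mod_cast le_top))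
    rwa [(chartAt E p).left_inv hx]
  · have h2 := h.comp x (contMDiffAt_of_mem_maximalAtlas (I := 𝓘(ℝ, E)) (n := ∞)
      (IsManifold.chart_mem_maximalAtlas p) hx |>.of_le (by exact_mod_cast le_top))
    refine h2.congr_of_eventuallyEq ?_
    filter_upwards [(chartAt E p).open_source.mem_nhds hx] with z hz
    simp [(chartAt E p).left_inv hz]

theorem mvfderiv_eq_fderiv (hx : x ∈ (chartAt E p).source) (hf : MDiffAt f x)
    (v : TangentSpace 𝓘(ℝ, E) x) :
    d% f x v = fderiv ℝ (f ∘ (chartAt E p).symm) (chartAt E p x) (toModel p x v) := by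
  have h1 := mfderiv_comp (I := 𝓘(ℝ, E)) (I' := 𝓘(ℝ, E)) (I'' := 𝓘(ℝ, F)) (g := f)
    (f := (chartAt E p).symm) (chartAt E p x)
    (by rwa [(chartAt E p).left_inv hx])
    ((contMDiffAt_chartAt_symm hx).mdifferentiableAt (by simp))
  rw [mfderiv_eq_fderiv] at h1
  have h2 : fderiv ℝ (f ∘ (chartAt E p).symm) (chartAt E p x) (toModel p x v) =
      mfderiv 𝓘(ℝ, E) 𝓘(ℝ, F) f ((chartAt E p).symm (chartAt E p x))
        (ofModel p ((chartAt E p).symm (chartAt E p x)) (toModel p x v)) := by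
    have h3 := mfderiv_chartAt_symm (p := p) ((chartAt E p).map_source hx) (toModel p x v)
    rw [← h3]
    generalize (toModel p x v : E) = w
    exact DFunLike.congr_fun h1 w
  rw [h2, (chartAt E p).left_inv hx, ofModel_toModel hx]
  rfl

theorem fieldRep_chart (hx : x ∈ (chartAt E p).source) (X : Π x : M, TangentSpace 𝓘(ℝ, E) x) :
    fieldRep p X (chartAt E p x) = toModel p x (X x) := by
  rw [fieldRep, (chartAt E p).left_inv hx]

variable {X Y Z : Π x : M, TangentSpace 𝓘(ℝ, E) x}

theorem eventually_chartAt_symm_mem (hx : x ∈ (chartAt E p).source) :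
    ∀ᶠ y in 𝓝 (chartAt E p x), (chartAt E p).symm y ∈ (chartAt E p).source ∧
      chartAt E p ((chartAt E p).symm y) = y := by
  filter_upwards [(chartAt E p).open_target.mem_nhds ((chartAt E p).map_source hx)] with y hy
  exact ⟨(chartAt E p).map_target hy, (chartAt E p).right_inv hy⟩

theorem mdifferentiableAt_field_iff (hx : x ∈ (chartAt E p).source) :
    MDiffAt (T% X) x ↔ DifferentiableAt ℝ (fieldRep p X) (chartAt E p x) := by
  rw [(trivializationAt E (TangentSpace 𝓘(ℝ, E)) p).mdifferentiableAt_section_iff 𝓘(ℝ, E) X hx,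
    mdifferentiableAt_iff_comp_chart hx]
  refine Filter.EventuallyEq.differentiableAt_iff ?_
  filter_upwards [eventually_chartAt_symm_mem hx] with y hy
  simp [fieldRep, toModel_eq hy.1]

theorem contMDiffAt_field_iff {n : ℕ∞} (hx : x ∈ (chartAt E p).source) :
    CMDiffAt n (T% X) x ↔ ContDiffAt ℝ n (fieldRep p X) (chartAt E p x) := by
  rw [(trivializationAt E (TangentSpace 𝓘(ℝ, E)) p).contMDiffAt_section_iff hx,
    contMDiffAt_iff_comp_chart hx]
  have h : (fun x ↦ (trivializationAt E (TangentSpace 𝓘(ℝ, E)) p ⟨x, X x⟩).2) ∘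
      (chartAt E p).symm =ᶠ[𝓝 (chartAt E p x)] fieldRep p X := by
    filter_upwards [eventually_chartAt_symm_mem hx] with y hy
    simp [fieldRep, toModel_eq hy.1]
  exact ⟨fun h' ↦ h'.congr_of_eventuallyEq h.symm, fun h' ↦ h'.congr_of_eventuallyEq h⟩

theorem two_le_infty : (2 : ℕ∞ω) ≤ ∞ := by
  exact WithTop.coe_le_coe.2 (le_top : (2 : ℕ∞) ≤ ⊤)

/-- The Lie bracket is natural under pullback, here along the inverse chart, and in a vector space
it is the bracket given by ordinary derivatives. -/
theorem toModel_mlieBracket (hx : x ∈ (chartAt E p).source) (hX : MDiffAt (T% X) x)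
    (hY : MDiffAt (T% Y) x) :
    toModel p x (mlieBracket 𝓘(ℝ, E) X Y x) =
      fderiv ℝ (fieldRep p Y) (chartAt E p x) (toModel p x (X x))
      - fderiv ℝ (fieldRep p X) (chartAt E p x) (toModel p x (Y x)) := by
  have : IsManifold 𝓘(ℝ, E) (minSmoothness ℝ 2) M := by
    rw [minSmoothness_of_isRCLikeNormedField]
    exact .of_le (n := ∞) two_le_infty
  have hpull (Z : Π x : M, TangentSpace 𝓘(ℝ, E) x) {y : E}
      (hy : (chartAt E p).symm y ∈ (chartAt E p).source ∧
        chartAt E p ((chartAt E p).symm y) = y) :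
      mpullback 𝓘(ℝ, E) 𝓘(ℝ, E) (chartAt E p).symm Z y = fieldRep p Z y := by
    have h1 := mfderiv_chartAt_symm (p := p) (y := y) (hy.2 ▸ (chartAt E p).map_source hy.1)
    have h1' : (mfderiv 𝓘(ℝ, E) 𝓘(ℝ, E) (chartAt E p).symm y).inverse =
        (ofModel p ((chartAt E p).symm y)).inverse :=
      congrArg ContinuousLinearMap.inverse (ContinuousLinearMap.ext h1)
    rw [mpullback_apply, fieldRep, h1']
    have h2 : (ofModel p ((chartAt E p).symm y)).IsInvertible :=
      .of_inverse (g := toModel p ((chartAt E p).symm y))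
        (ContinuousLinearMap.ext (ofModel_toModel hy.1))
        (ContinuousLinearMap.ext (toModel_ofModel hy.1))
    refine h2.inverse_apply_eq.2 ?_
    rw [ofModel_toModel hy.1]
  have hx' := eventually_chartAt_symm_mem hx
  have hl := (chartAt E p).left_inv hx
  have h1 := mpullback_mlieBracket (I := 𝓘(ℝ, E)) (I' := 𝓘(ℝ, E)) (n := ∞)
    (f := (chartAt E p).symm) (V := X) (W := Y) (x₀ := chartAt E p x) (by rwa [hl]) (by rwa [hl])
    (contMDiffAt_chartAt_symm hx)
    (by rw [minSmoothness_of_isRCLikeNormedField]; exact two_le_infty)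
  rw [hpull _ hx'.self_of_nhds, fieldRep_chart hx] at h1
  rw [h1]
  have h2 : mlieBracket 𝓘(ℝ, E) (mpullback 𝓘(ℝ, E) 𝓘(ℝ, E) (chartAt E p).symm X)
      (mpullback 𝓘(ℝ, E) 𝓘(ℝ, E) (chartAt E p).symm Y) (chartAt E p x) =
      mlieBracket 𝓘(ℝ, E) (fieldRep p X) (fieldRep p Y) (chartAt E p x) :=
    Filter.EventuallyEq.mlieBracket_vectorField_eq (hx'.mono fun y hy ↦ hpull X hy)
      (hx'.mono fun y hy ↦ hpull Y hy)
  have h3 : mlieBracket 𝓘(ℝ, E) (fieldRep p X) (fieldRep p Y) (chartAt E p x) =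
      lieBracket ℝ (fieldRep p X) (fieldRep p Y) (chartAt E p x) := by
    have h4 := mlieBracketWithin_eq_lieBracketWithin (𝕜 := ℝ) (V := fieldRep p X)
      (W := fieldRep p Y) (s := Set.univ)
    rw [lieBracketWithin_univ] at h4
    exact congrFun h4 _
  rw [h2]
  refine h3.trans ?_
  rw [lieBracket, fieldRep_chart hx, fieldRep_chart hx]

/-- The vector field whose coordinates in the chart at `p` are constant. -/
def constField (p : M) (u : E) (x : M) : TangentSpace 𝓘(ℝ, E) x := ofModel p x u

theorem fieldRep_constField (hx : x ∈ (chartAt E p).source) (u : E) :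
    fieldRep p (constField p u) =ᶠ[𝓝 (chartAt E p x)] fun _ ↦ u := by
  filter_upwards [eventually_chartAt_symm_mem hx] with y hy
  rw [fieldRep, constField, toModel_ofModel hy.1]

theorem contMDiffAt_constField (hx : x ∈ (chartAt E p).source) (u : E) :
    CMDiffAt ∞ (T% (constField p u)) x :=
  (contMDiffAt_field_iff (n := ⊤) hx).2
    (contDiffAt_const.congr_of_eventuallyEq (fieldRep_constField hx u))

theorem mdifferentiableAt_constField (hx : x ∈ (chartAt E p).source) (u : E) :
    MDiffAt (T% (constField p u)) x :=
  (contMDiffAt_constField hx u).mdifferentiableAt (by simp)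

theorem fderiv_fieldRep_constField (hx : x ∈ (chartAt E p).source) (u : E) :
    fderiv ℝ (fieldRep p (constField p u)) (chartAt E p x) = 0 := by
  rw [(fieldRep_constField hx u).fderiv_eq]
  exact fderiv_const_apply u

/-! ### Metric, connection and curvature in a chart. -/

variable (g : ContMDiffRiemannianMetric 𝓘(ℝ, E) ∞ E (fun x : M ↦ TangentSpace 𝓘(ℝ, E) x))

/-- The metric in the chart at `p`. -/
def metricRep (p : M) (y : E) : E →L[ℝ] E →L[ℝ] ℝ :=
  (ofModel p ((chartAt E p).symm y)).precomp ℝ ∘L g.inner ((chartAt E p).symm y) ∘L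
    ofModel p ((chartAt E p).symm y)

theorem metricRep_apply (y u v : E) : metricRep g p y u v =
    g.inner ((chartAt E p).symm y) (ofModel p _ u) (ofModel p _ v) := rfl

theorem metricRep_chart (hx : x ∈ (chartAt E p).source) (u v : TangentSpace 𝓘(ℝ, E) x) :
    metricRep g p (chartAt E p x) (toModel p x u) (toModel p x v) = g.inner x u v := by
  rw [metricRep_apply, (chartAt E p).left_inv hx, ofModel_toModel hx, ofModel_toModel hx]

theorem metricRep_symm (y u v : E) : metricRep g p y u v = metricRep g p y v u :=
  g.symm _ _ _

theorem metricRep_isInvertible (hx : x ∈ (chartAt E p).source) :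
    (metricRep g p (chartAt E p x)).IsInvertible := by
  refine isInvertible_of_pos fun v hv ↦ ?_
  rw [metricRep_apply, (chartAt E p).left_inv hx]
  refine g.pos _ _ fun h ↦ hv ?_
  rw [← toModel_ofModel hx v, h, map_zero]

theorem contDiffAt_metricRep (hx : x ∈ (chartAt E p).source) :
    ContDiffAt ℝ ∞ (metricRep g p) (chartAt E p x) := by
  refine contDiffAt_of_clm_apply fun u ↦ contDiffAt_of_clm_apply fun v ↦ ?_
  have h : CMDiffAt ∞ (fun x ↦ g.inner x (constField p u x) (constField p v x)) x := by
    have : ContMDiffAt 𝓘(ℝ, E) (𝓘(ℝ, E).prod 𝓘(ℝ)) ∞ (fun m ↦ TotalSpace.mk' ℝ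
        (E := Bundle.Trivial M ℝ) m (g.inner m (constField p u m) (constField p v m))) x :=
      ContMDiffAt.clm_bundle_apply₂ (F₁ := E) (F₂ := E) g.contMDiff.contMDiffAt
        (contMDiffAt_constField hx u) (contMDiffAt_constField hx v)
    simp only [contMDiffAt_totalSpace] at this
    exact this.2
  exact (contMDiffAt_iff_comp_chart (n := ⊤) hx).1 h

/-- The Christoffel symbols in the chart at `p`. -/
def christoffelRep (p : M) : E → E →L[ℝ] E →L[ℝ] E := christoffel (metricRep g p)

theorem christoffelRep_symm (hx : x ∈ (chartAt E p).source) (u v : E) :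
    christoffelRep g p (chartAt E p x) u v = christoffelRep g p (chartAt E p x) v u :=
  christoffel_symm (metricRep_isInvertible g hx) (.of_forall fun z ↦ metricRep_symm g z)
    ((contDiffAt_metricRep g hx).differentiableAt (by simp)) u v

theorem compatible_christoffelRep (hx : x ∈ (chartAt E p).source) :
    Compatible (christoffelRep g p) (metricRep g p) (chartAt E p x) :=
  compatible_christoffel (metricRep_isInvertible g hx) (.of_forall fun z ↦ metricRep_symm g z)
    ((contDiffAt_metricRep g hx).differentiableAt (by simp))

theorem eventually_compatible_christoffelRep (hx : x ∈ (chartAt E p).source) :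
    ∀ᶠ y in 𝓝 (chartAt E p x), Compatible (christoffelRep g p) (metricRep g p) y := by
  filter_upwards [eventually_chartAt_symm_mem hx] with y hy
  have := compatible_christoffelRep g hy.1
  rwa [hy.2] at this

theorem contDiffAt_christoffelRep (hx : x ∈ (chartAt E p).source) :
    ContDiffAt ℝ 2 (christoffelRep g p) (chartAt E p x) :=
  contDiffAt_christoffel (metricRep_isInvertible g hx) ((contDiffAt_metricRep g hx).of_le
    (WithTop.coe_le_coe.2 (le_top : (3 : ℕ∞) ≤ ⊤)))

theorem inner_comp_chart_symm (hx : x ∈ (chartAt E p).source) :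
    (fun z ↦ g.inner z (X z) (Y z)) ∘ (chartAt E p).symm =ᶠ[𝓝 (chartAt E p x)]
      fun y ↦ metricRep g p y (fieldRep p X y) (fieldRep p Y y) := by
  filter_upwards [eventually_chartAt_symm_mem hx] with y hy
  simp only [Function.comp, metricRep_apply, fieldRep, ofModel_toModel hy.1]

theorem mvfderiv_inner (hx : x ∈ (chartAt E p).source) (hX : MDiffAt (T% X) x)
    (hY : MDiffAt (T% Y) x) (v : TangentSpace 𝓘(ℝ, E) x) :
    d% (fun z ↦ g.inner z (X z) (Y z)) x v =
      fderiv ℝ (metricRep g p) (chartAt E p x) (toModel p x v) (toModel p x (X x))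
        (toModel p x (Y x))
      + metricRep g p (chartAt E p x)
        (fderiv ℝ (fieldRep p X) (chartAt E p x) (toModel p x v)) (toModel p x (Y x))
      + metricRep g p (chartAt E p x) (toModel p x (X x))
        (fderiv ℝ (fieldRep p Y) (chartAt E p x) (toModel p x v)) := by
  rw [mvfderiv_eq_fderiv hx (mdifferentiableAt_inner g hX hY),
    (inner_comp_chart_symm g hx).fderiv_eq]
  have hG := ((contDiffAt_metricRep g hx).differentiableAt (by simp)).hasFDerivAt
  have hX' := ((mdifferentiableAt_field_iff hx).1 hX).hasFDerivAt
  have hY' := ((mdifferentiableAt_field_iff hx).1 hY).hasFDerivAt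
  rw [((hG.clm_apply hX').clm_apply hY').fderiv]
  simp [fieldRep_chart hx]
  ring

/-- Both sides are tested, through the nondegenerate metric, against fields with constant
coordinates. For these the Koszul formula reduces to the Christoffel formula plus the derivative of
Y. -/
theorem toModel_leviCivita (hx : x ∈ (chartAt E p).source) (hY : MDiffAt (T% Y) x)
    (v : TangentSpace 𝓘(ℝ, E) x) :
    toModel p x (leviCivita g Y x v) =
      covField (christoffelRep g p) (fieldRep p Y) (chartAt E p x) (toModel p x v) := by
  refine (metricRep_isInvertible g hx).injective (ContinuousLinearMap.ext fun w ↦ ?_)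
  have hX := mdifferentiableAt_constField hx (toModel p x v)
  have hZ := mdifferentiableAt_constField hx w
  have hXx : constField p (toModel p x v) x = v := ofModel_toModel hx v
  have hZx : toModel p x (constField p w x) = w := toModel_ofModel hx w
  have h := inner_leviCivita g hX hY hZ
  rw [← metricRep_chart g hx, hXx, hZx] at h
  rw [h, koszul]
  simp only [← metricRep_chart g hx, mvfderiv_inner g hx hY hZ, mvfderiv_inner g hx hX hZ,
    mvfderiv_inner g hx hX hY, toModel_mlieBracket hx hX hY, toModel_mlieBracket hx hX hZ,
    toModel_mlieBracket hx hY hZ, fderiv_fieldRep_constField hx, hXx, hZx]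
  rw [covField, map_add, add_apply, christoffelRep, apply_christoffel (metricRep_isInvertible g hx),
    fieldRep_chart hx]
  simp
  rw [metricRep_symm g _ (toModel p x v)]
  ring

/-- C² regularity at x persists nearby, so the junk value of `leviCivita` is avoided on a
neighbourhood and the formula can be differentiated again. -/
theorem fieldRep_leviCivita (hx : x ∈ (chartAt E p).source) (hZ : CMDiffAt 2 (T% Z) x) :
    fieldRep p (fun z ↦ leviCivita g Z z (Y z)) =ᶠ[𝓝 (chartAt E p x)]
      fun y ↦ covField (christoffelRep g p) (fieldRep p Z) y (fieldRep p Y y) := by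
  have h1 := ((contMDiffAt_field_iff (n := 2) hx).1 hZ).eventually (by simp)
  filter_upwards [eventually_chartAt_symm_mem hx, h1] with y hy hy'
  have h2 : MDiffAt (T% Z) ((chartAt E p).symm y) := by
    rw [mdifferentiableAt_field_iff hy.1, hy.2]
    exact hy'.differentiableAt (by simp)
  rw [fieldRep, toModel_leviCivita g hy.1 h2, hy.2, fieldRep.eq_1 p Y]

theorem mdifferentiableAt_leviCivita (hx : x ∈ (chartAt E p).source) (hY : MDiffAt (T% Y) x)
    (hZ : CMDiffAt 2 (T% Z) x) : MDiffAt (T% (fun z ↦ leviCivita g Z z (Y z))) x := by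
  rw [mdifferentiableAt_field_iff hx, (fieldRep_leviCivita g hx hZ).differentiableAt_iff]
  have hY' := (mdifferentiableAt_field_iff hx).1 hY
  have hZ' := (contMDiffAt_field_iff (n := 2) hx).1 hZ
  have hΓ := (contDiffAt_christoffelRep g hx).differentiableAt (by norm_num)
  exact ((differentiableAt_fderiv hZ').clm_apply hY').add
    ((hΓ.clm_apply hY').clm_apply (hZ'.differentiableAt (by norm_num)))

theorem toModel_curvature (hx : x ∈ (chartAt E p).source) (hX : MDiffAt (T% X) x)
    (hY : MDiffAt (T% Y) x) (hZ : CMDiffAt 2 (T% Z) x) :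
    toModel p x (curvature g X Y Z x) =
      riem (christoffelRep g p) (chartAt E p x) (toModel p x (X x)) (toModel p x (Y x))
        (toModel p x (Z x)) := by
  have hX' := (mdifferentiableAt_field_iff hx).1 hX
  have hY' := (mdifferentiableAt_field_iff hx).1 hY
  have hZ' := (contMDiffAt_field_iff (n := 2) hx).1 hZ
  have h := curvature_covField ((contDiffAt_christoffelRep g hx).differentiableAt (by norm_num))
    hX' hY' hZ'
  have hcov {W : Π x : M, TangentSpace 𝓘(ℝ, E) x} (v : E) :
      covField (christoffelRep g p) (fieldRep p (fun z ↦ leviCivita g Z z (W z))) (chartAt E p x) v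
      = covField (christoffelRep g p)
        (fun y ↦ covField (christoffelRep g p) (fieldRep p Z) y (fieldRep p W y))
        (chartAt E p x) v := by
    rw [covField, covField, (fieldRep_leviCivita g hx hZ).fderiv_eq,
      (fieldRep_leviCivita g hx hZ).eq_of_nhds]
  simp only [fieldRep_chart hx] at h
  rw [curvature, map_sub, map_sub,
    toModel_leviCivita g hx (mdifferentiableAt_leviCivita g hx hY hZ),
    toModel_leviCivita g hx (mdifferentiableAt_leviCivita g hx hX hZ),
    toModel_leviCivita g hx (hZ.mdifferentiableAt (by norm_num)), toModel_mlieBracket hx hX hY,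
    hcov, hcov, h]

/-- The coordinates of tangent vectors, as a linear equivalence. -/
def toModelEquiv (hx : x ∈ (chartAt E p).source) : TangentSpace 𝓘(ℝ, E) x ≃ₗ[ℝ] E :=
  LinearEquiv.ofLinearMap (toModel p x).toLinearMap (ofModel p x).toLinearMap
    (LinearMap.ext (toModel_ofModel hx)) (LinearMap.ext (ofModel_toModel hx))

/-- The curvature is tensorial and the trace is independent of the basis, so the pointwise choices
of extensions and bases in `ricci` do not matter. Allowing x to vary in one chart makes the
differentiability of `ricci` visible. -/
theorem ricci_eq_ric (hx : x ∈ (chartAt E p).source) (v w : TangentSpace 𝓘(ℝ, E) x) :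
    ricci g x v w =
      ric (christoffelRep g p) (chartAt E p x) (toModel p x v) (toModel p x w) := by
  have h1 (u : TangentSpace 𝓘(ℝ, E) x) : MDiffAt (T% (extVec u)) x :=
    FiberBundle.mdifferentiableAt_extend 𝓘(ℝ, E) E u
  have h2 (u : TangentSpace 𝓘(ℝ, E) x) : CMDiffAt 2 (T% (extVec u)) x :=
    (FiberBundle.contMDiffAt_extend (k := ∞) 𝓘(ℝ, E) E u).of_le two_le_infty
  have h3 (u : TangentSpace 𝓘(ℝ, E) x) : extVec u x = u := FiberBundle.extend_apply_self E u
  rw [ric_eq_sum ((Module.finBasis ℝ (TangentSpace 𝓘(ℝ, E) x)).map (toModelEquiv hx))]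
  refine Finset.sum_congr rfl fun i _ ↦ ?_
  have h4 := toModel_curvature g hx (h1 (Module.finBasis ℝ (TangentSpace 𝓘(ℝ, E) x) i)) (h1 v)
    (h2 w)
  rw [h3, h3, h3] at h4
  have h5 : (Module.finBasis ℝ (TangentSpace 𝓘(ℝ, E) x)).map (toModelEquiv hx) i =
    toModel p x (Module.finBasis ℝ (TangentSpace 𝓘(ℝ, E) x) i) := rfl
  rw [h5, ← h4]
  change _ = (Module.finBasis ℝ (TangentSpace 𝓘(ℝ, E) x)).coord i (ofModel p x _)
  rw [ofModel_toModel hx]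

/-! ### The contracted Bianchi identity -/

/-- The extension of a vector at p has constant coordinates in the chart at p, so its covariant
derivative at p consists of the Christoffel term alone. -/
theorem extVec_eq_constField (hx : x ∈ (chartAt E p).source) (v : TangentSpace 𝓘(ℝ, E) p) :
    extVec v x = constField p (toModel p p v) x := by
  rw [toModel_eq (mem_chart_source E p), extVec, FiberBundle.extend, constField, ofModel]
  exact (Trivialization.symmL_apply (trivializationAt E (TangentSpace 𝓘(ℝ, E)) p) hx _).symm

theorem fieldRep_extVec (v : TangentSpace 𝓘(ℝ, E) p) :
    fieldRep p (extVec v) =ᶠ[𝓝 (chartAt E p p)] fun _ ↦ toModel p p v := by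
  filter_upwards [eventually_chartAt_symm_mem (mem_chart_source E p)] with y hy
  rw [fieldRep, extVec_eq_constField hy.1, constField, toModel_ofModel hy.1]

theorem mdifferentiableAt_extVec (v : TangentSpace 𝓘(ℝ, E) p) : MDiffAt (T% (extVec v)) p :=
  FiberBundle.mdifferentiableAt_extend 𝓘(ℝ, E) E v

@[simp]
theorem extVec_self (v : TangentSpace 𝓘(ℝ, E) p) : extVec v p = v :=
  FiberBundle.extend_apply_self E v

theorem covDerivRicci_eq_covRic (u v w : TangentSpace 𝓘(ℝ, E) p) :
    covDerivRicci g p u v w = covRic (christoffelRep g p) (chartAt E p p)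
      (toModel p p u) (toModel p p v) (toModel p p w) := by
  have hx := mem_chart_source E p
  have h1 (v : TangentSpace 𝓘(ℝ, E) p) : toModel p p (leviCivita g (extVec v) p u) =
      christoffelRep g p (chartAt E p p) (toModel p p u) (toModel p p v) := by
    rw [toModel_leviCivita g hx (mdifferentiableAt_extVec v), covField, fieldRep_chart hx,
      extVec_self, (fieldRep_extVec v).fderiv_eq]
    simp
  have h2 : (fun x ↦ ricci g x (extVec v x) (extVec w x)) ∘ (chartAt E p).symm
      =ᶠ[𝓝 (chartAt E p p)]
      fun y ↦ ric (christoffelRep g p) y (toModel p p v) (toModel p p w) := by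
    filter_upwards [eventually_chartAt_symm_mem hx] with y hy
    rw [Function.comp, extVec_eq_constField hy.1, extVec_eq_constField hy.1, ricci_eq_ric g hy.1, hy.2,
      constField, constField, toModel_ofModel hy.1, toModel_ofModel hy.1]
  have h3 : MDiffAt (fun x ↦ ricci g x (extVec v x) (extVec w x)) p := by
    rw [mdifferentiableAt_iff_comp_chart hx, h2.differentiableAt_iff]
    exact (hasFDerivAt_ric (contDiffAt_christoffelRep g hx) (Module.finBasis ℝ E) _
      _).differentiableAt
  rw [covDerivRicci, mvfderiv_eq_fderiv hx h3, h2.fderiv_eq, ricci_eq_ric g hx,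
    ricci_eq_ric g hx, h1, h1, covRic]

theorem sum_covDerivRicci (u : TangentSpace 𝓘(ℝ, E) p) {ι : Type*} [Fintype ι]
    (b : Module.Basis ι ℝ (TangentSpace 𝓘(ℝ, E) p)) :
    ∑ k, covDerivRicci g p u (b k) (sharp g p (b.coord k).toContinuousLinearMap) =
      2 * ∑ k, covDerivRicci g p (b k) u (sharp g p (b.coord k).toContinuousLinearMap) := by
  have hx := mem_chart_source E p
  simp only [covDerivRicci_eq_covRic]
  refine sum_covRic (contDiffAt_christoffelRep g hx)
    ((contDiffAt_metricRep g hx).of_le two_le_infty)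
    (christoffelRep_symm g hx) (eventually_compatible_christoffelRep g hx) (metricRep_symm g _)
    (b.map (toModelEquiv hx))
    (b' := fun k ↦ toModel p p (sharp g p (b.coord k).toContinuousLinearMap)) (fun i v ↦ ?_) _
  conv_lhs => rw [← toModel_ofModel hx v]
  rw [metricRep_chart g hx, inner_sharp]
  rfl

theorem sum_smul_sharp_coord {ι : Type*} [Fintype ι]
    (b : Module.Basis ι ℝ (TangentSpace 𝓘(ℝ, E) p)) (α : TangentSpace 𝓘(ℝ, E) p →L[ℝ] ℝ) :
    ∑ k, α (b k) • sharp g p (b.coord k).toContinuousLinearMap = sharp g p α := by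
  simp only [← map_smul, ← map_sum]
  congr 1
  ext v
  conv_rhs => rw [← b.sum_repr v, map_sum]
  simp [mul_comm]

theorem sum_apply_sharp_coord_smul {ι : Type*} [Fintype ι]
    (b : Module.Basis ι ℝ (TangentSpace 𝓘(ℝ, E) p)) (α : TangentSpace 𝓘(ℝ, E) p →L[ℝ] ℝ) :
    ∑ k, α (sharp g p (b.coord k).toContinuousLinearMap) • b k = sharp g p α := by
  have h (k) : α (sharp g p (b.coord k).toContinuousLinearMap) = b.coord k (sharp g p α) := by
    rw [← inner_sharp g p α, g.symm, inner_sharp]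
    rfl
  simp only [h, Module.Basis.coord_apply, b.sum_repr]

/-- The Ricci tensor annihilates the vector field which is dual to the one form of a pseudo Ricci
symmetric metric. -/
theorem IsPseudoRicciSymmetric.ricci_sharp {α : OneForm 𝓘(ℝ, E) M}
    (h : IsPseudoRicciSymmetric g α)
    {T : TangentSpace 𝓘(ℝ, E) p →L[ℝ] TangentSpace 𝓘(ℝ, E) p →L[ℝ] ℝ}
    (hT : ∀ v w, ricci g p v w = T v w) (hs : ∀ v w, T v w = T w v)
    (u : TangentSpace 𝓘(ℝ, E) p) : ricci g p u (sharp g p (α p)) = 0 := by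
  let b := Module.finBasis ℝ (TangentSpace 𝓘(ℝ, E) p)
  let b' := fun k ↦ sharp g p (b.coord k).toContinuousLinearMap
  have h0 : ∑ k, covDerivRicci g p u (b k) (b' k) = 2 * ∑ k, covDerivRicci g p (b k) u (b' k) :=
    sum_covDerivRicci g u b
  have h1 : ∑ k, α p (b k) * T u (b' k) = T u (sharp g p (α p)) := by
    simp [← sum_smul_sharp_coord g b (α p), map_sum, b']
  have h2 : ∑ k, α p (b' k) * T u (b k) = T u (sharp g p (α p)) := by
    conv_rhs => rw [← sum_apply_sharp_coord_smul g b (α p), map_sum]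
    simp [b']
  -- After contraction the scalar curvature terms agree on both sides, leaving 2 Ri(u, α♯) = 6 Ri(u,
  -- α♯).
  simp only [h.eq, hT, hs _ u, Finset.sum_add_distrib, mul_assoc, ← Finset.mul_sum, h1, h2] at h0
  rw [hT]
  have h3 : ∑ k, T (b k) (b' k) = ∑ k, T (b' k) (b k) := Finset.sum_congr rfl fun k _ ↦ hs _ _
  linarith

/-! ### Differentiation of the quasi Einstein equation -/

theorem coInner_comm (α β : TangentSpace 𝓘(ℝ, E) p →L[ℝ] ℝ) :
    coInner g p α β = coInner g p β α := by
  rw [coInner, coInner, ← inner_sharp, g.symm, inner_sharp]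

theorem coInner_self_pos {α : TangentSpace 𝓘(ℝ, E) p →L[ℝ] ℝ} (h : α ≠ 0) :
    0 < coInner g p α α := by
  rw [coInner, ← inner_sharp]
  refine g.pos _ _ fun h' ↦ h (ContinuousLinearMap.ext fun v ↦ ?_)
  rw [← inner_sharp g, h']
  simp

theorem OneForm.IsSmooth.contMDiff_apply {θ : OneForm 𝓘(ℝ, E) M} (h : θ.IsSmooth)
    (hX : CMDiffAt ∞ (T% X) x) : CMDiffAt ∞ (fun z ↦ θ z (X z)) x := by
  have : ContMDiffAt 𝓘(ℝ, E) (𝓘(ℝ, E).prod 𝓘(ℝ)) ∞ (fun m ↦ TotalSpace.mk' ℝ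
      (E := Bundle.Trivial M ℝ) m (θ m (X m))) x :=
    ContMDiffAt.clm_bundle_apply (F₁ := E) h.contMDiffAt hX
  simp only [contMDiffAt_totalSpace] at this
  exact this.2

/-- A one form in the chart at `p`. -/
def formRep (p : M) (θ : OneForm 𝓘(ℝ, E) M) (y : E) : E →L[ℝ] ℝ :=
  θ ((chartAt E p).symm y) ∘L ofModel p ((chartAt E p).symm y)

theorem contDiffAt_formRep {θ : OneForm 𝓘(ℝ, E) M} (h : θ.IsSmooth)
    (hx : x ∈ (chartAt E p).source) : ContDiffAt ℝ ∞ (formRep p θ) (chartAt E p x) :=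
  contDiffAt_of_clm_apply fun u ↦
    (contMDiffAt_iff_comp_chart (n := ⊤) hx).1 (h.contMDiff_apply (contMDiffAt_constField hx u))

/-- In a chart, raising an index is applying the inverse of the metric, and inversion of operators
is smooth. -/
theorem mdifferentiableAt_sharp {θ : OneForm 𝓘(ℝ, E) M} (h : θ.IsSmooth) :
    MDiffAt (T% (fun x ↦ sharp g x (θ x))) p := by
  have hx := mem_chart_source E p
  have h1 : fieldRep p (fun x ↦ sharp g x (θ x)) =ᶠ[𝓝 (chartAt E p p)]
      fun y ↦ (metricRep g p y).inverse (formRep p θ y) := by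
    filter_upwards [eventually_chartAt_symm_mem hx] with y hy
    have hG := metricRep_isInvertible g hy.1
    rw [hy.2] at hG
    refine (hG.inverse_apply_eq.2 (ContinuousLinearMap.ext fun w ↦ ?_)).symm
    rw [metricRep_apply, fieldRep, ofModel_toModel hy.1, inner_sharp]
    rfl
  rw [mdifferentiableAt_field_iff hx, h1.differentiableAt_iff]
  have h2 : DifferentiableAt ℝ (fun y ↦ (metricRep g p y).inverse) (chartAt E p p) :=
    (((metricRep_isInvertible g hx).contDiffAt_map_inverse (n := ∞)).comp (chartAt E p p)
      (contDiffAt_metricRep g hx)).differentiableAt (by simp)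
  exact h2.clm_apply ((contDiffAt_formRep h hx).differentiableAt (by simp))

/-- The musical isomorphism is parallel, by metric compatibility. -/
theorem covDerivForm_eq_inner {θ : OneForm 𝓘(ℝ, E) M} (h : θ.IsSmooth)
    (u v : TangentSpace 𝓘(ℝ, E) p) :
    covDerivForm g θ p u v = g.inner p (leviCivita g (fun x ↦ sharp g x (θ x)) p u) v := by
  have h1 := leviCivita_metric g (mdifferentiableAt_sharp g h) (mdifferentiableAt_extVec v) u
  simp only [inner_sharp, extVec_self] at h1
  rw [covDerivForm, h1]
  ring

theorem mdifferentiableAt_coInner {θ : OneForm 𝓘(ℝ, E) M} (h : θ.IsSmooth) :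
    MDiffAt (fun x ↦ coInner g x (θ x) (θ x)) p := by
  have h1 := mdifferentiableAt_inner g (mdifferentiableAt_sharp g h (p := p))
    (mdifferentiableAt_sharp g h)
  simpa only [inner_sharp] using! h1

theorem mvfderiv_coInner {θ : OneForm 𝓘(ℝ, E) M} (h : θ.IsSmooth) (u : TangentSpace 𝓘(ℝ, E) p) :
    d% (fun x ↦ coInner g x (θ x) (θ x)) p u =
      2 * covDerivForm g θ p u (sharp g p (θ p)) := by
  have h1 := leviCivita_metric g (mdifferentiableAt_sharp g h) (mdifferentiableAt_sharp g h) u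
  simp only [inner_sharp] at h1
  have h2 : (fun x ↦ coInner g x (θ x) (θ x)) = fun x ↦ θ x (sharp g x (θ x)) := rfl
  rw [h2, h1, covDerivForm_eq_inner g h, g.symm, inner_sharp]
  ring

namespace IsQuasiEinstein

variable {g} {a b : M → ℝ} {θ : OneForm 𝓘(ℝ, E) M}

theorem mdifferentiableAt_div (h : IsQuasiEinstein g a b θ) :
    MDiffAt (fun x ↦ b x / coInner g x (θ x) (θ x)) p := by
  have hx := mem_chart_source E p
  have h1 := (mdifferentiableAt_iff_comp_chart hx).1 ((h.smooth_b p).mdifferentiableAt (by simp))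
  have h2 := (mdifferentiableAt_iff_comp_chart hx).1
    (mdifferentiableAt_coInner g h.smooth_form (p := p))
  have h3 : ((fun x ↦ coInner g x (θ x) (θ x)) ∘ (chartAt E p).symm) (chartAt E p p) ≠ 0 :=
    (coInner_self_pos g (h.ne_zero _)).ne'
  exact (mdifferentiableAt_iff_comp_chart hx).2 (h1.mul (h2.inv h3))

theorem ricci_eq (h : IsQuasiEinstein g a b θ) (v w : TangentSpace 𝓘(ℝ, E) p) :
    ricci g p v w = a p * g.inner p v w + b p / coInner g p (θ p) (θ p) * (θ p v * θ p w) := by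
  rw [h.eq]
  ring

/-- Leibniz rule with g parallel. Keeping b/|θ|² as a single coefficient avoids differentiating the
norm here. -/
theorem covDerivRicci_eq (h : IsQuasiEinstein g a b θ) (u v w : TangentSpace 𝓘(ℝ, E) p) :
    covDerivRicci g p u v w = d% a p u * g.inner p v w
      + d% (fun x ↦ b x / coInner g x (θ x) (θ x)) p u * (θ p v * θ p w)
      + b p / coInner g p (θ p) (θ p) *
        (covDerivForm g θ p u v * θ p w + θ p v * covDerivForm g θ p u w) := by
  have ha : MDiffAt a p := (h.smooth_a p).mdifferentiableAt (by simp)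
  have hb := h.mdifferentiableAt_div (p := p)
  have hθ (v : TangentSpace 𝓘(ℝ, E) p) : MDiffAt (fun x ↦ θ x (extVec v x)) p :=
    (h.smooth_form.contMDiff_apply
      (FiberBundle.contMDiffAt_extend (k := ∞) 𝓘(ℝ, E) E v)).mdifferentiableAt (by simp)
  have hg := mdifferentiableAt_inner g (mdifferentiableAt_extVec v) (mdifferentiableAt_extVec w)
  have h1 : (fun x ↦ ricci g x (extVec v x) (extVec w x)) = fun x ↦
      a x * g.inner x (extVec v x) (extVec w x) + b x / coInner g x (θ x) (θ x) *
        (θ x (extVec v x) * θ x (extVec w x)) := funext fun x ↦ h.ricci_eq _ _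
  have h2 := mvfderiv_fun_add (ha.mul hg) (hb.mul ((hθ v).mul (hθ w)))
  simp only [Pi.mul_apply] at h2
  rw [covDerivRicci, h1, h2, mvfderiv_mul ha hg, mvfderiv_mul hb ((hθ v).mul (hθ w)),
    mvfderiv_mul (hθ v) (hθ w), h.ricci_eq, h.ricci_eq]
  simp [leviCivita_metric g (mdifferentiableAt_extVec v) (mdifferentiableAt_extVec w),
    covDerivForm]
  ring

theorem ricci_sharp (h : IsQuasiEinstein g a b θ) {α : OneForm 𝓘(ℝ, E) M}
    (hα : IsPseudoRicciSymmetric g α) (v : TangentSpace 𝓘(ℝ, E) p) :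
    a p * α p v + b p / coInner g p (θ p) (θ p) * (coInner g p (θ p) (α p) * θ p v) = 0 := by
  -- The quasi Einstein expression itself supplies the bilinear symmetric representative of `ricci`,
  -- so symmetry of the Ricci tensor needs no separate proof.
  have h1 := hα.ricci_sharp g (T := a p • g.inner p +
    (b p / coInner g p (θ p) (θ p)) • (θ p).smulRight (θ p)) (p := p) (fun v w ↦ by
      simp [h.ricci_eq]) (fun v w ↦ by
      simp [g.symm p v w, mul_comm (θ p v)]) v
  rw [h.ricci_eq, g.symm, inner_sharp] at h1
  rw [← h1, coInner.eq_1 g p (θ p) (α p)]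
  ring

/-- Compare the two expressions for (∇_u Ri)(v, v) at a nonzero v in the kernel of θ, where Ri acts
as a. There a α(v) = 0 by `ricci_sharp`, which removes the mixed terms. -/
theorem mvfderiv_a (h : IsQuasiEinstein g a b θ) {α : OneForm 𝓘(ℝ, E) M}
    (hα : IsPseudoRicciSymmetric g α) (hE : 2 ≤ Module.finrank ℝ E)
    (u : TangentSpace 𝓘(ℝ, E) p) : d% a p u = 2 * α p u * a p := by
  -- In dimension at least 2 a linear functional cannot be injective.
  obtain ⟨v, hv, hv0⟩ : ∃ v, θ p v = 0 ∧ v ≠ 0 := by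
    by_contra! hc
    have h1 := LinearMap.finrank_le_finrank_of_injective (f := (θ p).toLinearMap)
      ((injective_iff_map_eq_zero (θ p)).2 hc)
    rw [Module.finrank_self] at h1
    have : Module.finrank ℝ (TangentSpace 𝓘(ℝ, E) p) = Module.finrank ℝ E := rfl
    omega
  have h1 := h.covDerivRicci_eq u v v
  have h2 := h.ricci_sharp hα v
  rw [hα.eq, h.ricci_eq, h.ricci_eq, h.ricci_eq] at h1
  simp only [hv, mul_zero, add_zero, zero_mul] at h1 h2
  have h3 : d% a p u * g.inner p v v = 2 * α p u * a p * g.inner p v v := by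
    linear_combination -h1 + g.inner p u v * h2 + g.inner p v u * h2
  exact mul_right_cancel₀ (g.pos p v hv0).ne' h3

/-- The vector θ♯ is an eigenvector of Ri with eigenvalue a + b; compare the two expressions for
(∇_u Ri)(θ♯, θ♯). The mixed terms carry the factor (a + b) g(θ, α), which vanishes by `ricci_sharp`
at θ♯. -/
theorem mvfderiv_a_add_b (h : IsQuasiEinstein g a b θ) {α : OneForm 𝓘(ℝ, E) M}
    (hα : IsPseudoRicciSymmetric g α) (u : TangentSpace 𝓘(ℝ, E) p) :
    d% (fun x ↦ a x + b x) p u = 2 * α p u * (a p + b p) := by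
  have ha : MDiffAt a p := (h.smooth_a p).mdifferentiableAt (by simp)
  have hN := (coInner_self_pos g (h.ne_zero p)).ne'
  -- Written as (b/|θ|²)·|θ|², b has a derivative in the quantities that occur in ∇Ri.
  have hb' : b = fun x ↦ b x / coInner g x (θ x) (θ x) * coInner g x (θ x) (θ x) :=
    funext fun x ↦ (div_mul_cancel₀ _ (coInner_self_pos g (h.ne_zero x)).ne').symm
  have hb : d% b p u = d% (fun x ↦ b x / coInner g x (θ x) (θ x)) p u * coInner g p (θ p) (θ p)
      + b p / coInner g p (θ p) (θ p) * (2 * covDerivForm g θ p u (sharp g p (θ p))) := by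
    conv_lhs => rw [hb', mvfderiv_fun_mul h.mdifferentiableAt_div
      (mdifferentiableAt_coInner g h.smooth_form)]
    simp [mvfderiv_coInner g h.smooth_form]
    ring
  have h1 := h.covDerivRicci_eq u (sharp g p (θ p)) (sharp g p (θ p))
  have h2 := h.ricci_sharp hα (sharp g p (θ p))
  have h3 : θ p (sharp g p (θ p)) = coInner g p (θ p) (θ p) := rfl
  have h4 : α p (sharp g p (θ p)) = coInner g p (θ p) (α p) := coInner_comm g _ _
  rw [hα.eq, h.ricci_eq, h.ricci_eq, h.ricci_eq] at h1
  simp only [g.symm p u, inner_sharp, h3, h4] at h1 h2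
  rw [mvfderiv_fun_add ha ((h.smooth_b p).mdifferentiableAt (by simp)), add_apply, hb]
  generalize coInner g p (θ p) (θ p) = N at *
  refine mul_right_cancel₀ hN ?_
  field_simp at h1 h2 ⊢
  linear_combination -h1 + 2 * θ p u * h2

end IsQuasiEinstein

variable {g}

/-! ### Functions with logarithmic derivative `2 α` -/

/-- Along a coordinate segment starting at a zero, f solves a linear homogeneous ODE with bounded
coefficient, so it stays zero by Grönwall's inequality. -/
theorem isOpen_setOf_eq_zero {α : OneForm 𝓘(ℝ, E) M} (hα : α.IsSmooth) {f : M → ℝ}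
    (hf : ContMDiff 𝓘(ℝ, E) 𝓘(ℝ) ∞ f)
    (h : ∀ (q : M) (u : TangentSpace 𝓘(ℝ, E) q), d% f q u = 2 * α q u * f q) :
    IsOpen {q | f q = 0} := by
  rw [isOpen_iff_mem_nhds]
  intro p hp
  have hx := mem_chart_source E p
  have hd {y : E} (hy : y ∈ (chartAt E p).target) (u : E) :
      HasFDerivAt (f ∘ (chartAt E p).symm) (fderiv ℝ (f ∘ (chartAt E p).symm) y) y ∧
      fderiv ℝ (f ∘ (chartAt E p).symm) y u = 2 * formRep p α y u * f ((chartAt E p).symm y) := by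
    have hq := (chartAt E p).map_target hy
    have hfq : MDiffAt f ((chartAt E p).symm y) := (hf _).mdifferentiableAt (by simp)
    have h1 := mvfderiv_eq_fderiv hq hfq (ofModel p _ u)
    have h2 := (mdifferentiableAt_iff_comp_chart hq).1 hfq
    rw [h, toModel_ofModel hq, (chartAt E p).right_inv hy] at h1
    rw [(chartAt E p).right_inv hy] at h2
    exact ⟨h2.hasFDerivAt, h1.symm⟩
  have hcont : ContinuousAt (formRep p α) (chartAt E p p) :=
    (contDiffAt_formRep hα hx).continuousAt
  -- A ball inside the chart on which α has norm less than its norm at the centre plus 1. This gives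
  -- the uniform constant C for Grönwall.
  obtain ⟨r, hr, hball⟩ := Metric.eventually_nhds_iff_ball.1
    ((hcont.norm.eventually_lt continuousAt_const (lt_add_one _)).and
      ((chartAt E p).open_target.mem_nhds ((chartAt E p).map_source hx)))
  set C := ‖formRep p α (chartAt E p p)‖ + 1
  have hzero (y : E) (hy : y ∈ Metric.ball (chartAt E p p) r) :
      f ((chartAt E p).symm y) = 0 := by
    set y₀ := chartAt E p p
    have hseg {t : ℝ} (ht : t ∈ Set.Icc (0 : ℝ) 1) : y₀ + t • (y - y₀) ∈ Metric.ball y₀ r :=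
      (convex_ball y₀ r).add_smul_sub_mem (Metric.mem_ball_self hr) hy ht
    have hder {t : ℝ} (ht : t ∈ Set.Icc (0 : ℝ) 1) :
        HasDerivAt (fun t : ℝ ↦ f ((chartAt E p).symm (y₀ + t • (y - y₀))))
          (2 * formRep p α (y₀ + t • (y - y₀)) (y - y₀) *
            f ((chartAt E p).symm (y₀ + t • (y - y₀)))) t := by
      obtain ⟨h1, h2⟩ := hd (hball _ (hseg ht)).2 (y - y₀)
      rw [← h2]
      refine HasFDerivAt.comp_hasDerivAt (f := fun t : ℝ ↦ y₀ + t • (y - y₀)) t h1 ?_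
      simpa using ((hasDerivAt_id t).smul_const (y - y₀)).const_add y₀
    have h3 := eq_zero_of_abs_deriv_le_mul_abs_self_of_eq_zero_right
      (f := fun t : ℝ ↦ f ((chartAt E p).symm (y₀ + t • (y - y₀)))) (a := 0) (b := 1)
      (K := 2 * (C * ‖y - y₀‖))
      (fun t ht ↦ (hder ht).continuousAt.continuousWithinAt)
      (fun t ht ↦ (hder (Set.Ico_subset_Icc_self ht)).hasDerivWithinAt)
      (by simpa [y₀, (chartAt E p).left_inv hx] using hp)
      (fun t ht ↦ by
        rw [norm_mul, norm_mul, Real.norm_two]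
        gcongr
        exact (ContinuousLinearMap.le_opNorm _ _).trans (by
          gcongr
          exact (hball _ (hseg (Set.Ico_subset_Icc_self ht))).1.le)) 1 (by simp)
    simpa using h3
  have hnhds : (chartAt E p) ⁻¹' Metric.ball (chartAt E p p) r ∈ 𝓝 p :=
    ((chartAt E p).continuousAt hx).preimage_mem_nhds (Metric.ball_mem_nhds _ hr)
  filter_upwards [hnhds, (chartAt E p).open_source.mem_nhds hx] with q hq hq'
  have := hzero _ hq
  rwa [(chartAt E p).left_inv hq'] at this

theorem isClopen_setOf_eq_zero {α : OneForm 𝓘(ℝ, E) M} (hα : α.IsSmooth) {f : M → ℝ}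
    (hf : ContMDiff 𝓘(ℝ, E) 𝓘(ℝ) ∞ f)
    (h : ∀ (q : M) (u : TangentSpace 𝓘(ℝ, E) q), d% f q u = 2 * α q u * f q) :
    IsClopen {q | f q = 0} :=
  ⟨isClosed_eq hf.continuous continuous_const, isOpen_setOf_eq_zero hα hf h⟩

/-! ### The two cases a ≠ 0 and a = 0. -/

namespace IsQuasiEinstein

variable {a b : M → ℝ} {α θ : OneForm 𝓘(ℝ, E) M}

theorem isClopen_a (h : IsQuasiEinstein g a b θ) (hα : IsPseudoRicciSymmetric g α)
    (hE : 2 ≤ Module.finrank ℝ E) : IsClopen {q | a q = 0} :=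
  isClopen_setOf_eq_zero hα.smooth h.smooth_a fun _ u ↦ h.mvfderiv_a hα hE u

theorem isClopen_a_add_b (h : IsQuasiEinstein g a b θ) (hα : IsPseudoRicciSymmetric g α) :
    IsClopen {q | a q + b q = 0} :=
  isClopen_setOf_eq_zero (f := fun q ↦ a q + b q) hα.smooth (h.smooth_a.add h.smooth_b)
    fun _ u ↦ h.mvfderiv_a_add_b hα u

/-- If a and b both vanished at p, the clopen zero sets of a and a + b would contain the component
of p, and Ri would vanish there. This is where non-vanishing of Ri on components enters. -/
theorem b_ne_zero (h : IsQuasiEinstein g a b θ) (hα : IsPseudoRicciSymmetric g α)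
    (hE : 2 ≤ Module.finrank ℝ E)
    (hRi : ∃ q ∈ connectedComponent p, ∃ v w, ricci g q v w ≠ 0) (ha : a p = 0) : b p ≠ 0 := by
  intro hb
  obtain ⟨q, hq, v, w, hvw⟩ := hRi
  have h1 : a q = 0 := (h.isClopen_a hα hE).connectedComponent_subset ha hq
  have h2 : a q + b q = 0 := (h.isClopen_a_add_b hα).connectedComponent_subset
    (show a p + b p = 0 by rw [ha, hb, add_zero]) hq
  have h3 : b q = 0 := by linarith
  exact hvw (by rw [h.ricci_eq, h1, h3]; simp)

theorem scalarCurvature_eq (h : IsQuasiEinstein g a b θ) :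
    scalarCurvature g p = Module.finrank ℝ E * a p + b p := by
  let B := Module.finBasis ℝ (TangentSpace 𝓘(ℝ, E) p)
  have h1 (i) : g.inner p (B i) (sharp g p (B.coord i).toContinuousLinearMap) = 1 := by
    rw [g.symm, inner_sharp]
    simp
  have h2 : ∑ i, θ p (B i) * θ p (sharp g p (B.coord i).toContinuousLinearMap) =
      coInner g p (θ p) (θ p) := by
    rw [coInner, ← sum_smul_sharp_coord g B (θ p), map_sum]
    simp
  have h3 : Module.finrank ℝ (TangentSpace 𝓘(ℝ, E) p) = Module.finrank ℝ E := rfl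
  change ∑ i, ricci g p (B i) (sharp g p (B.coord i).toContinuousLinearMap) = _
  simp only [h.ricci_eq, h1, Finset.sum_add_distrib, ← Finset.mul_sum, h2]
  rw [div_mul_cancel₀ _ (coInner_self_pos g (h.ne_zero p)).ne']
  simp [h3, mul_comm]

/-- The identity a α + (b/N) c θ = 0 makes α a multiple of θ and forces b = -a, so Ri is a times the
projection orthogonal to α, and its trace is (n - 1) a. -/
theorem ricci_of_a_ne_zero (h : IsQuasiEinstein g a b θ) (hα : IsPseudoRicciSymmetric g α)
    (hE : 2 ≤ Module.finrank ℝ E) (ha : a p ≠ 0) (hαp : α p ≠ 0) (v w : TangentSpace 𝓘(ℝ, E) p) :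
    ricci g p v w = scalarCurvature g p / ((Module.finrank ℝ E : ℝ) - 1) *
      (g.inner p v w - α p v * α p w / coInner g p (α p) (α p)) := by
  have hN := (coInner_self_pos g (h.ne_zero p)).ne'
  have hK := (coInner_self_pos g hαp).ne'
  have h1 := h.ricci_sharp hα (p := p)
  have hαα : α p (sharp g p (α p)) = coInner g p (α p) (α p) := rfl
  have hθα : θ p (sharp g p (α p)) = coInner g p (θ p) (α p) := rfl
  have hαθ : α p (sharp g p (θ p)) = coInner g p (θ p) (α p) := coInner_comm g _ _
  have hθθ : θ p (sharp g p (θ p)) = coInner g p (θ p) (θ p) := rfl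
  have h2 := h1 (sharp g p (α p))
  have h3 := h1 (sharp g p (θ p))
  rw [hαα, hθα] at h2
  rw [hαθ, hθθ] at h3
  have h4 := h1 v
  have h5 := h1 w
  have hE' : (Module.finrank ℝ E : ℝ) - 1 ≠ 0 := by
    have : (2 : ℝ) ≤ Module.finrank ℝ E := by exact_mod_cast hE
    linarith
  rw [h.ricci_eq, h.scalarCurvature_eq]
  generalize coInner g p (θ p) (θ p) = N at *
  generalize coInner g p (θ p) (α p) = c at *
  generalize coInner g p (α p) (α p) = K at *
  -- If c = 0, the identity at α♯ becomes a |α|² = 0.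
  have hc : c ≠ 0 := by
    rintro rfl
    simp [ha, hK] at h2
  -- The identity at θ♯ is c (a + b) = 0.
  have hab : b p = -a p := by
    field_simp at h3
    have : c * (a p + b p) = 0 := by linear_combination h3
    linarith [(mul_eq_zero.1 this).resolve_left hc]
  rw [hab] at h2 h4 h5 ⊢
  have h6 : (Module.finrank ℝ E * a p + -a p) / ((Module.finrank ℝ E : ℝ) - 1) = a p := by
    field_simp
    ring
  rw [h6]
  have k2 : N * K = c ^ 2 := by
    field_simp at h2
    exact mul_left_cancel₀ ha (by linear_combination h2)
  have k4 : N * α p v = c * θ p v := by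
    field_simp at h4
    exact mul_left_cancel₀ ha (by linear_combination h4)
  have k5 : N * α p w = c * θ p w := by
    field_simp at h5
    exact mul_left_cancel₀ ha (by linear_combination h5)
  -- Since N α = c θ and N K = c², the normalized squares of α and θ coincide.
  have k6 : N * (α p v * α p w) = K * (θ p v * θ p w) := mul_left_cancel₀ hN (by
    linear_combination k4 * (N * α p w) + c * θ p v * k5 - θ p v * θ p w * k2)
  field_simp
  linear_combination k6

theorem coInner_eq_zero
    (h : IsQuasiEinstein g a b θ) (hα : IsPseudoRicciSymmetric g α) (ha : a p = 0) (hb : b p ≠ 0) :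
    coInner g p (θ p) (α p) = 0 := by
  have hN := (coInner_self_pos g (h.ne_zero p)).ne'
  have h1 := h.ricci_sharp hα (sharp g p (θ p))
  have hθθ : θ p (sharp g p (θ p)) = coInner g p (θ p) (θ p) := rfl
  rw [ha, hθθ] at h1
  field_simp at h1
  simpa [hb] using h1

theorem mvfderiv_a_eq_zero (h : IsQuasiEinstein g a b θ) (hα : IsPseudoRicciSymmetric g α)
    (hE : 2 ≤ Module.finrank ℝ E) (ha : a p = 0) (u : TangentSpace 𝓘(ℝ, E) p) :
    d% a p u = 0 := by
  rw [h.mvfderiv_a hα hE, ha, mul_zero]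

/-- Compare the two expressions for (∇_u Ri)(α♯, θ♯). As θ(α♯) = 0 and da = 0, only b (∇_u θ)(α♯)
and |α|² Ri(u, θ♯) = b |α|² θ(u) survive. -/
theorem covDerivForm_sharp (h : IsQuasiEinstein g a b θ) (hα : IsPseudoRicciSymmetric g α)
    (hE : 2 ≤ Module.finrank ℝ E) (ha : a p = 0) (hb : b p ≠ 0) (u : TangentSpace 𝓘(ℝ, E) p) :
    covDerivForm g θ p u (sharp g p (α p)) = coInner g p (α p) (α p) * θ p u := by
  have hN := (coInner_self_pos g (h.ne_zero p)).ne'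
  have h0 : θ p (sharp g p (α p)) = 0 := h.coInner_eq_zero hα ha hb
  have hαα : α p (sharp g p (α p)) = coInner g p (α p) (α p) := rfl
  have h1 := h.covDerivRicci_eq u (sharp g p (α p)) (sharp g p (θ p))
  have hθθ : θ p (sharp g p (θ p)) = coInner g p (θ p) (θ p) := rfl
  rw [hα.eq, h.ricci_eq, h.ricci_eq, h.ricci_eq, h.mvfderiv_a_eq_zero hα hE ha] at h1
  simp only [ha, h0, hαα, hθθ] at h1
  generalize coInner g p (θ p) (θ p) = N at *
  field_simp at h1
  exact mul_left_cancel₀ (mul_ne_zero hb hN) (by linear_combination -h1)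

/-- Under the scaling, b/|θ|² is locally constant, so ∇_{α♯} Ri = 2|α|² Ri becomes an equation for
the symmetric product of θ with ∇_{α♯} θ, which determines ∇_{α♯} θ. -/
theorem covDerivForm_of_sharp (h : IsQuasiEinstein g a b θ) (hα : IsPseudoRicciSymmetric g α)
    (hE : 2 ≤ Module.finrank ℝ E) (ha : a p = 0) (hb : b p ≠ 0) {c : ℝ}
    (hc : ∀ᶠ q in 𝓝 p, scalarCurvature g q = c * coInner g q (θ q) (θ q))
    (v : TangentSpace 𝓘(ℝ, E) p) :
    covDerivForm g θ p (sharp g p (α p)) v = coInner g p (α p) (α p) * θ p v := by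
  have hN := (coInner_self_pos g (h.ne_zero p)).ne'
  have h0 : θ p (sharp g p (α p)) = 0 := h.coInner_eq_zero hα ha hb
  have hαα : α p (sharp g p (α p)) = coInner g p (α p) (α p) := rfl
  have hθθ : θ p (sharp g p (θ p)) = coInner g p (θ p) (θ p) := rfl
  -- The zero set of a is open, so sc = b holds near p and not only at p.
  have hconst : (fun q ↦ b q / coInner g q (θ q) (θ q)) =ᶠ[𝓝 p] fun _ ↦ c := by
    filter_upwards [hc, (h.isClopen_a hα hE).isOpen.mem_nhds ha] with q hq hq'
    rw [h.scalarCurvature_eq, show a q = 0 from hq', mul_zero, zero_add] at hq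
    rw [hq, mul_div_cancel_right₀ _ (coInner_self_pos g (h.ne_zero q)).ne']
  have hd : d% (fun q ↦ b q / coInner g q (θ q) (θ q)) p = 0 := by
    rw [mvfderiv, hconst.mfderiv_eq, mfderiv_const]
    rfl
  have key (v w : TangentSpace 𝓘(ℝ, E) p) :
      2 * coInner g p (α p) (α p) * (θ p v * θ p w) =
        covDerivForm g θ p (sharp g p (α p)) v * θ p w
        + θ p v * covDerivForm g θ p (sharp g p (α p)) w := by
    have h1 := h.covDerivRicci_eq (sharp g p (α p)) v w
    rw [hα.eq, h.ricci_eq, h.ricci_eq, h.ricci_eq, h.mvfderiv_a_eq_zero hα hE ha, hd] at h1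
    simp only [ha, h0, hαα, zero_apply] at h1
    generalize coInner g p (θ p) (θ p) = N at *
    field_simp at h1
    exact mul_left_cancel₀ hb (by linear_combination h1)
  -- Both slots at θ♯ give the θ♯ component of ∇_{α♯} θ; with it, one slot at θ♯ gives all
  -- components.
  have h2 := key (sharp g p (θ p)) (sharp g p (θ p))
  have h3 := key v (sharp g p (θ p))
  rw [hθθ] at h2 h3
  have h4 : covDerivForm g θ p (sharp g p (α p)) (sharp g p (θ p)) =
      coInner g p (α p) (α p) * coInner g p (θ p) (θ p) :=
    mul_right_cancel₀ hN (by linear_combination -h2 / 2)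
  rw [h4] at h3
  exact mul_right_cancel₀ hN (by linear_combination -h3)

end IsQuasiEinstein

end RicciGeometry

end

theorem mainTheorem6 {n : ℕ} (hn : 3 ≤ n)
    {M : Type*} [TopologicalSpace M] [ChartedSpace (EuclideanSpace ℝ (Fin n)) M]
    [IsManifold (𝓡 n) ∞ M]
    (g : ContMDiffRiemannianMetric (𝓡 n) ∞ (EuclideanSpace ℝ (Fin n))
      (fun x : M ↦ TangentSpace (𝓡 n) x))
    (hRi : ∀ p : M, ∃ q ∈ connectedComponent p, ∃ v w, RicciGeometry.ricci g q v w ≠ 0)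
    (α θ : RicciGeometry.OneForm (𝓡 n) M) (a b : M → ℝ)
    (hPRS : RicciGeometry.IsPseudoRicciSymmetric g α)
    (hQE : RicciGeometry.IsQuasiEinstein g a b θ) (p : M) :
    (a p ≠ 0 → α p ≠ 0 → ∀ v w : TangentSpace (𝓡 n) p,
      RicciGeometry.ricci g p v w = RicciGeometry.scalarCurvature g p / ((n : ℝ) - 1) *
        (g.inner p v w - α p v * α p w / RicciGeometry.coInner g p (α p) (α p))) ∧
    (a p = 0 →
      RicciGeometry.coInner g p (θ p) (α p) = 0 ∧
      (∀ v w : TangentSpace (𝓡 n) p,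
        RicciGeometry.ricci g p v w = RicciGeometry.scalarCurvature g p *
          (θ p v * θ p w / RicciGeometry.coInner g p (θ p) (θ p))) ∧
      (∀ u : TangentSpace (𝓡 n) p,
        RicciGeometry.covDerivForm g θ p u (RicciGeometry.sharp g p (α p)) =
          RicciGeometry.coInner g p (α p) (α p) * θ p u) ∧
      (∀ c : ℝ, (∀ᶠ q in 𝓝 p,
          RicciGeometry.scalarCurvature g q = c * RicciGeometry.coInner g q (θ q) (θ q)) →
        ∀ v : TangentSpace (𝓡 n) p,
          RicciGeometry.covDerivForm g θ p (RicciGeometry.sharp g p (α p)) v =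
            RicciGeometry.coInner g p (α p) (α p) * θ p v)) := by
  have hrank : Module.finrank ℝ (EuclideanSpace ℝ (Fin n)) = n := finrank_euclideanSpace_fin
  have hE : 2 ≤ Module.finrank ℝ (EuclideanSpace ℝ (Fin n)) := by omega
  refine ⟨fun ha hα v w ↦ ?_, fun ha ↦ ?_⟩
  · have h := hQE.ricci_of_a_ne_zero hPRS hE ha hα v w
    rwa [hrank] at h
  · have hb := hQE.b_ne_zero hPRS hE (hRi p) ha
    refine ⟨hQE.coInner_eq_zero hPRS ha hb, fun v w ↦ ?_,
      hQE.covDerivForm_sharp hPRS hE ha hb,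
      fun c hc ↦ hQE.covDerivForm_of_sharp hPRS hE ha hb hc⟩
    rw [hQE.eq, hQE.scalarCurvature_eq, ha]
    ring
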